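/- \textbf{Theorem.} Let $T$ be a left-invariant $(0,2)$ tensor field on $SL(2)=SL(2,\mathbb{R})$, and let $\mathfrak{g}$ be the Lie algebra of $SL(2)$. By a Milnor basis we mean a basis $V_1,V_2,V_3$ of $\mathfrak{g}$ with $$[V_i,V_j]=\sum_{k=1}^{3}\epsilon_{ijk}\lambda_kV_k,\qquad \lambda_1=\lambda_2=2,\ \lambda_3=-2,$$ where $\epsilon_{ijk}$ is the Levi-Civita symbol. There exist a left-invariant Riemannian metric $g$ and a constant $c>0$ such that $\mathrm{Ric}(g)=cT$ if and only if there is a Milnor basis in which $T$ is diagonal, $T(V_i,V_j)=\delta_{ij}T_i$, and one of the following conditions is satisfied: (i) $T_1>0$, $T_2,T_3<0$, $-T_1<T_3$; (ii) $T_2>0$, $T_1,T_3<0$, $-T_2<T_3$; (iii) $T_1,T_2<0$, $T_3>0$, $\max\{-T_1,-T_2\}<T_3$; (iv) $T_1,T_2<0$, $T_3>0$, $\min\{-T_1,-T_2\}>T_3$; (v) $T_1=T_2=-T_3<0$; (vi) $T_1<0$, $T_2=T_3=0$; (vii) $T_2<0$, $T_1=T_3=0$. In cases (i)--(iv) the solution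 $(g,c)$ is unique up to scaling of $g$: if $(\bar g,\bar c)$ is another pair consisting of a left-invariant Riemannian metric and a positive constant with $\mathrm{Ric}(\bar g)=\bar cT$, then $\bar c=c$ and $\bar g$ is a positive scalar multiple of $g$. In cases (v)--(vii) there are infinitely many solutions $(g,c)$, no two of whose metrics are scalar multiples of each other, but $c$ is the same for all solutions. -/

import Mathlib

open scoped Manifold ContDiff Matrix

noncomputable section

/-- The group `SL(2, ℝ)`, with its topology as a subspace of the space of matrices. -/
abbrev SL2R : Type := Matrix.SpecialLinearGroup (Fin 2) ℝ

namespace SL2R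

/-- The matrix entries, as functions on `SL(2, ℝ)`. -/
def entry (i j : Fin 2) (M : SL2R) : ℝ := M.1 i j

theorem continuous_entry (i j : Fin 2) : Continuous (entry i j) :=
  (continuous_subtype_val).matrix_elem i j

theorem det_entry (M : SL2R) : entry 0 0 M * entry 1 1 M - entry 0 1 M * entry 1 0 M = 1 := by
  have := M.2
  rwa [Matrix.det_fin_two] at this

theorem ext_entry {M N : SL2R} (h00 : entry 0 0 M = entry 0 0 N) (h01 : entry 0 1 M = entry 0 1 N)
    (h10 : entry 1 0 M = entry 1 0 N) (h11 : entry 1 1 M = entry 1 1 N) : M = N := by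
  apply Subtype.ext
  ext i j
  fin_cases i <;> fin_cases j <;> assumption

/-- The matrix with entries `a b; c d` if its determinant is one, and the identity otherwise. -/
def mk (a b c d : ℝ) : SL2R :=
  if h : a * d - b * c = 1 then ⟨!![a, b; c, d], by rw [Matrix.det_fin_two_of, h]⟩ else 1

theorem entry_mk {a b c d : ℝ} (h : a * d - b * c = 1) :
    entry 0 0 (mk a b c d) = a ∧ entry 0 1 (mk a b c d) = b ∧ entry 1 0 (mk a b c d) = c ∧
      entry 1 1 (mk a b c d) = d := by
  simp [mk, h, entry]

theorem mk_entry (M : SL2R) : mk (entry 0 0 M) (entry 0 1 M) (entry 1 0 M) (entry 1 1 M) = M := by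
  obtain ⟨h1, h2, h3, h4⟩ := entry_mk (det_entry M)
  exact ext_entry h1 h2 h3 h4

theorem continuousOn_mk {X : Type*} [TopologicalSpace X] {s : Set X} {a b c d : X → ℝ}
    (ha : ContinuousOn a s) (hb : ContinuousOn b s) (hc : ContinuousOn c s)
    (hd : ContinuousOn d s) (h : ∀ x ∈ s, a x * d x - b x * c x = 1) :
    ContinuousOn (fun x => mk (a x) (b x) (c x) (d x)) s := by
  have hind : Topology.IsInducing fun M : SL2R => M.1 := ⟨rfl⟩
  rw [hind.continuousOn_iff]
  refine continuousOn_pi.2 fun i => continuousOn_pi.2 fun j => ?_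
  have key : ∀ x ∈ s, _ := fun x hx => entry_mk (h x hx)
  fin_cases i <;> fin_cases j
  · exact ha.congr fun x hx => (key x hx).1
  · exact hb.congr fun x hx => (key x hx).2.1
  · exact hc.congr fun x hx => (key x hx).2.2.1
  · exact hd.congr fun x hx => (key x hx).2.2.2

/-- The chart `(a b; c d) ↦ (a, b, c)` on the open set `a ≠ 0`. -/
def chartA : OpenPartialHomeomorph SL2R (ℝ × ℝ × ℝ) where
  toFun M := (entry 0 0 M, entry 0 1 M, entry 1 0 M)
  invFun p := mk p.1 p.2.1 p.2.2 ((1 + p.2.1 * p.2.2) / p.1)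
  source := {M | entry 0 0 M ≠ 0}
  target := {p | p.1 ≠ 0}
  map_source' M hM := hM
  map_target' p hp := by
    have hp' : p.1 ≠ 0 := hp
    have h := entry_mk (a := p.1) (b := p.2.1) (c := p.2.2) (d := (1 + p.2.1 * p.2.2) / p.1)
      (by field_simp; ring)
    simpa [h.1] using hp'
  left_inv' M hM := by
    have hM' : entry 0 0 M ≠ 0 := hM
    have : (1 + entry 0 1 M * entry 1 0 M) / entry 0 0 M = entry 1 1 M := by
      rw [div_eq_iff hM']; linarith [det_entry M]
    simp only [this, mk_entry]
  right_inv' p hp := by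
    have hp' : p.1 ≠ 0 := hp
    have h := entry_mk (a := p.1) (b := p.2.1) (c := p.2.2) (d := (1 + p.2.1 * p.2.2) / p.1)
      (by field_simp; ring)
    simp only [h.1, h.2.1, h.2.2.1]
  open_source := isOpen_ne_fun (continuous_entry 0 0) continuous_const
  open_target := isOpen_ne_fun continuous_fst continuous_const
  continuousOn_toFun := ((continuous_entry 0 0).prodMk
    ((continuous_entry 0 1).prodMk (continuous_entry 1 0))).continuousOn
  continuousOn_invFun := by
    apply continuousOn_mk
    · fun_prop
    · fun_prop
    · fun_prop
    · exact ContinuousOn.div (by fun_prop) (by fun_prop) fun p hp => hp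
    · intro p hp
      have hp' : p.1 ≠ 0 := hp
      field_simp
      ring

/-- The chart `(a b; c d) ↦ (a, c, d)` on the open set `c ≠ 0`. -/
def chartC : OpenPartialHomeomorph SL2R (ℝ × ℝ × ℝ) where
  toFun M := (entry 0 0 M, entry 1 0 M, entry 1 1 M)
  invFun p := mk p.1 ((p.1 * p.2.2 - 1) / p.2.1) p.2.1 p.2.2
  source := {M | entry 1 0 M ≠ 0}
  target := {p | p.2.1 ≠ 0}
  map_source' M hM := hM
  map_target' p hp := by
    have hp' : p.2.1 ≠ 0 := hp
    have h := entry_mk (a := p.1) (b := (p.1 * p.2.2 - 1) / p.2.1) (c := p.2.1) (d := p.2.2)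
      (by field_simp; ring)
    simpa [h.2.2.1] using hp'
  left_inv' M hM := by
    have hM' : entry 1 0 M ≠ 0 := hM
    have : (entry 0 0 M * entry 1 1 M - 1) / entry 1 0 M = entry 0 1 M := by
      rw [div_eq_iff hM']; linarith [det_entry M]
    simp only [this, mk_entry]
  right_inv' p hp := by
    have hp' : p.2.1 ≠ 0 := hp
    have h := entry_mk (a := p.1) (b := (p.1 * p.2.2 - 1) / p.2.1) (c := p.2.1) (d := p.2.2)
      (by field_simp; ring)
    simp only [h.1, h.2.2.1, h.2.2.2]
  open_source := isOpen_ne_fun (continuous_entry 1 0) continuous_const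
  open_target := isOpen_ne_fun (continuous_fst.comp continuous_snd) continuous_const
  continuousOn_toFun := ((continuous_entry 0 0).prodMk
    ((continuous_entry 1 0).prodMk (continuous_entry 1 1))).continuousOn
  continuousOn_invFun := by
    apply continuousOn_mk
    · fun_prop
    · exact ContinuousOn.div (by fun_prop) (by fun_prop) fun p hp => hp
    · fun_prop
    · fun_prop
    · intro p hp
      have hp' : p.2.1 ≠ 0 := hp
      field_simp
      ring

open Classical in
/-- The smooth structure of `SL(2, ℝ)`, given by the two charts `chartA` and `chartC`. By
`contMDiff_entry` and `contMDiff_of_entry` below it is the structure of an embedded submanifold of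
the space of matrices: a map into `SL(2, ℝ)` is smooth if and only if its entries are. -/
instance : ChartedSpace (ℝ × ℝ × ℝ) SL2R where
  atlas := {chartA, chartC}
  chartAt M := if entry 0 0 M ≠ 0 then chartA else chartC
  mem_chart_source M := by
    split_ifs with h
    · exact h
    · intro h0
      have := det_entry M
      rw [not_not.1 h, h0] at this
      simp at this
  chart_mem_atlas M := by split_ifs <;> simp

theorem contDiffOn_entry_chartA_symm (n : ℕ∞ω) (i j : Fin 2) :
    ContDiffOn ℝ n (fun p => entry i j (chartA.symm p)) chartA.target := by
  have key : ∀ p ∈ chartA.target, _ := fun p (hp : p.1 ≠ 0) =>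
    entry_mk (a := p.1) (b := p.2.1) (c := p.2.2) (d := (1 + p.2.1 * p.2.2) / p.1)
      (by field_simp; ring)
  fin_cases i <;> fin_cases j
  · exact (contDiff_fst.contDiffOn).congr fun p hp => (key p hp).1
  · exact ((contDiff_fst.comp contDiff_snd).contDiffOn).congr fun p hp => (key p hp).2.1
  · exact ((contDiff_snd.comp contDiff_snd).contDiffOn).congr fun p hp => (key p hp).2.2.1
  · refine ContDiffOn.congr (f := fun p : ℝ × ℝ × ℝ => (1 + p.2.1 * p.2.2) / p.1) ?_
      fun p hp => (key p hp).2.2.2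
    exact ContDiffOn.div (by fun_prop) (by fun_prop) fun p hp => hp

theorem contDiffOn_entry_chartC_symm (n : ℕ∞ω) (i j : Fin 2) :
    ContDiffOn ℝ n (fun p => entry i j (chartC.symm p)) chartC.target := by
  have key : ∀ p ∈ chartC.target, _ := fun p (hp : p.2.1 ≠ 0) =>
    entry_mk (a := p.1) (b := (p.1 * p.2.2 - 1) / p.2.1) (c := p.2.1) (d := p.2.2)
      (by field_simp; ring)
  fin_cases i <;> fin_cases j
  · exact (contDiff_fst.contDiffOn).congr fun p hp => (key p hp).1
  · refine ContDiffOn.congr (f := fun p : ℝ × ℝ × ℝ => (p.1 * p.2.2 - 1) / p.2.1) ?_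
      fun p hp => (key p hp).2.1
    exact ContDiffOn.div (by fun_prop) (by fun_prop) fun p hp => hp
  · exact ((contDiff_fst.comp contDiff_snd).contDiffOn).congr fun p hp => (key p hp).2.2.1
  · exact ((contDiff_snd.comp contDiff_snd).contDiffOn).congr fun p hp => (key p hp).2.2.2

theorem contDiffOn_entry_symm (n : ℕ∞ω) (i j : Fin 2) {e : OpenPartialHomeomorph SL2R (ℝ × ℝ × ℝ)}
    (he : e ∈ atlas (ℝ × ℝ × ℝ) SL2R) :
    ContDiffOn ℝ n (fun p => entry i j (e.symm p)) e.target := by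
  rcases he with rfl | rfl
  · exact contDiffOn_entry_chartA_symm n i j
  · exact contDiffOn_entry_chartC_symm n i j

instance (n : ℕ∞ω) : IsManifold 𝓘(ℝ, ℝ × ℝ × ℝ) n SL2R := by
  apply isManifold_of_contDiffOn
  intro e e' he he'
  have h : ∀ i j, ContDiffOn ℝ n (fun p => entry i j (e.symm p)) (e.symm ≫ₕ e').source := fun i j =>
    (contDiffOn_entry_symm n i j he).mono fun p hp => hp.1
  have hs : 𝓘(ℝ, ℝ × ℝ × ℝ).symm ⁻¹' (e.symm ≫ₕ e').source ∩ Set.range 𝓘(ℝ, ℝ × ℝ × ℝ) =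
    (e.symm ≫ₕ e').source := by simp
  rw [hs]
  rcases he' with rfl | rfl
  · exact (h 0 0).prodMk ((h 0 1).prodMk (h 1 0))
  · exact (h 0 0).prodMk ((h 1 0).prodMk (h 1 1))

theorem contMDiff_entry (n : ℕ∞ω) (i j : Fin 2) :
    ContMDiff 𝓘(ℝ, ℝ × ℝ × ℝ) 𝓘(ℝ, ℝ) n (entry i j) := by
  intro M
  rw [contMDiffAt_iff]
  refine ⟨(continuous_entry i j).continuousAt, ?_⟩
  have hM := mem_chart_source (ℝ × ℝ × ℝ) M
  have := (contDiffOn_entry_symm n i j (chart_mem_atlas (ℝ × ℝ × ℝ) M)).contDiffAt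
    ((chartAt (ℝ × ℝ × ℝ) M).open_target.mem_nhds ((chartAt (ℝ × ℝ × ℝ) M).map_source hM))
  exact this.contDiffWithinAt

theorem contMDiff_of_entry {E H X : Type*} [NormedAddCommGroup E] [NormedSpace ℝ E]
    [TopologicalSpace H] {I : ModelWithCorners ℝ E H} [TopologicalSpace X] [ChartedSpace H X]
    {n : ℕ∞ω} {f : X → SL2R} (h : ∀ i j, ContMDiff I 𝓘(ℝ, ℝ) n (fun x => entry i j (f x))) :
    ContMDiff I 𝓘(ℝ, ℝ × ℝ × ℝ) n f := by
  intro x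
  rw [contMDiffAt_iff_target]
  refine ⟨?_, ?_⟩
  · have : Continuous f := by
      refine continuous_induced_rng.2 (continuous_matrix fun i j => (h i j).continuous)
    exact this.continuousAt
  · rcases chart_mem_atlas (ℝ × ℝ × ℝ) (f x) with he | he
    · have : extChartAt 𝓘(ℝ, ℝ × ℝ × ℝ) (f x) ∘ f =
          fun y => (entry 0 0 (f y), entry 0 1 (f y), entry 1 0 (f y)) := by
        funext y; simp only [extChartAt, he]; rfl
      rw [this]
      exact ((h 0 0).prodMk_space ((h 0 1).prodMk_space (h 1 0))) x
    · have : extChartAt 𝓘(ℝ, ℝ × ℝ × ℝ) (f x) ∘ f =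
          fun y => (entry 0 0 (f y), entry 1 0 (f y), entry 1 1 (f y)) := by
        funext y; simp only [extChartAt, Set.mem_singleton_iff.1 he]; rfl
      rw [this]
      exact ((h 0 0).prodMk_space ((h 1 0).prodMk_space (h 1 1))) x

instance (n : ℕ∞ω) : LieGroup 𝓘(ℝ, ℝ × ℝ × ℝ) n SL2R where
  contMDiff_mul := by
    apply contMDiff_of_entry
    intro i j
    have : (fun p : SL2R × SL2R => entry i j (p.1 * p.2)) =
        fun p => entry i 0 p.1 * entry 0 j p.2 + entry i 1 p.1 * entry 1 j p.2 := by
      funext p; simp [entry, Matrix.mul_apply, Fin.sum_univ_two]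
    rw [this]
    exact (((contMDiff_entry n i 0).comp contMDiff_fst).mul
      ((contMDiff_entry n 0 j).comp contMDiff_snd)).add
      (((contMDiff_entry n i 1).comp contMDiff_fst).mul
      ((contMDiff_entry n 1 j).comp contMDiff_snd))
  contMDiff_inv := by
    apply contMDiff_of_entry
    intro i j
    fin_cases i <;> fin_cases j
    · exact (contMDiff_entry n 1 1).congr fun M => by
        simp [entry, Matrix.SpecialLinearGroup.coe_inv, Matrix.adjugate_fin_two]
    · exact (contMDiff_entry n 0 1).neg.congr fun M => by
        simp [entry, Matrix.SpecialLinearGroup.coe_inv, Matrix.adjugate_fin_two]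
    · exact (contMDiff_entry n 1 0).neg.congr fun M => by
        simp [entry, Matrix.SpecialLinearGroup.coe_inv, Matrix.adjugate_fin_two]
    · exact (contMDiff_entry n 0 0).congr fun M => by
        simp [entry, Matrix.SpecialLinearGroup.coe_inv, Matrix.adjugate_fin_two]

end SL2R

section LieGroupRicci

variable {E : Type*} [NormedAddCommGroup E] [NormedSpace ℝ E] {H : Type*} [TopologicalSpace H]
  {I : ModelWithCorners ℝ E H} {G : Type*} [TopologicalSpace G] [ChartedSpace H G]

variable (I G) in
/-- `(0,2)` tensor fields on `G`. No smoothness is built in; it is automatic for left-invariant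
tensor fields. -/
abbrev TensorField02 : Type _ := Π x : G, TangentSpace I x →L[ℝ] TangentSpace I x →L[ℝ] ℝ

variable [Group G]

/-- `T` is left-invariant: `(L_a)^* T = T` for every left translation `L_a`. -/
def TensorField02.IsLeftInvariant (T : TensorField02 I G) : Prop :=
  ∀ (a x : G) (u v : TangentSpace I x),
    T (a * x) (mfderiv I I (fun y => a * y) x u) (mfderiv I I (fun y => a * y) x v) = T x u v

/-- The left-invariant vector field with value `u` at `x`. -/
def leftExtend {x : G} (u : TangentSpace I x) : Π y : G, TangentSpace I y :=
  mulInvariantVectorField (I := I) (G := G) (mfderiv I I (fun y => x⁻¹ * y) x u)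

theorem leftExtend_apply_self [LieGroup I ∞ G] {x : G} (u : TangentSpace I x) :
    leftExtend u x = u := by
  have h1 : MDifferentiableAt I I (fun y : G => x⁻¹ * y) x :=
    (contMDiff_mul_left (n := ∞)).contMDiffAt.mdifferentiableAt (by simp)
  have h2 : ∀ z : G, MDifferentiableAt I I (fun y : G => x * y) z := fun z =>
    (contMDiff_mul_left (n := ∞)).contMDiffAt.mdifferentiableAt (by simp)
  have h3 := mfderiv_comp (I := I) (I' := I) (I'' := I) x (g := fun y : G => x * y) (h2 _) h1
  have h4 : (fun y : G => x * y) ∘ (fun y : G => x⁻¹ * y) = id := by ext y; simp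
  rw [h4, mfderiv_id] at h3
  have h5 := congrArg (fun L => L u) h3
  have h6 : ∀ z : G, z = 1 → ∀ w : E, (mfderiv I I (fun y : G => x * y) z : E → E) w =
      (mfderiv I I (fun y : G => x * y) 1 : E → E) w := by rintro z rfl w; rfl
  exact (h6 _ (inv_mul_cancel x) _).symm.trans h5.symm


/-- The right-hand side of the Koszul formula,
`X g(Y,Z) + Y g(X,Z) - Z g(X,Y) + g([X,Y],Z) - g([X,Z],Y) - g([Y,Z],X)`. -/
def koszul (g : TensorField02 I G) (X Y Z : Π x : G, TangentSpace I x) (x : G) : ℝ :=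
  mvfderiv I (fun y => g y (Y y) (Z y)) x (X x)
    + mvfderiv I (fun y => g y (X y) (Z y)) x (Y x)
    - mvfderiv I (fun y => g y (X y) (Y y)) x (Z x)
    + g x (VectorField.mlieBracket I X Y x) (Z x)
    - g x (VectorField.mlieBracket I X Z x) (Y x)
    - g x (VectorField.mlieBracket I Y Z x) (X x)

/-- The Levi-Civita derivative `∇_X Y` of a Riemannian metric `g` on a Lie group: its value at `x`
is the vector `u` such that `2 g(u, Z) = koszul g X Y Z` at `x`. For smooth `g`, `X`, `Y` the
right-hand side at `x` depends only on the value of `Z` at `x`, so it is enough to let `Z` run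
through the left-invariant vector fields; the vector `u` then exists and is unique. -/
def leviCivita (g : TensorField02 I G) (X Y : Π x : G, TangentSpace I x) :
    Π x : G, TangentSpace I x := fun x =>
  Classical.epsilon fun u : TangentSpace I x => ∀ w : GroupLieAlgebra I G,
    2 * g x u (mulInvariantVectorField w x) = koszul g X Y (mulInvariantVectorField w) x

/-- The curvature `R(X,Y)Z = ∇_X ∇_Y Z - ∇_Y ∇_X Z - ∇_[X,Y] Z`. -/
def riemannCurvature (g : TensorField02 I G) (X Y Z : Π x : G, TangentSpace I x) :
    Π x : G, TangentSpace I x :=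
  leviCivita g X (leviCivita g Y Z) - leviCivita g Y (leviCivita g X Z)
    - leviCivita g (VectorField.mlieBracket I X Y) Z

instance (x : G) [FiniteDimensional ℝ E] : FiniteDimensional ℝ (TangentSpace I x) :=
  inferInstanceAs (FiniteDimensional ℝ E)

/-- The Ricci tensor `Ric(u, v) = tr (w ↦ R(w, u) v)` of a Riemannian metric on a Lie group. The
trace is computed in a basis of the tangent space at `x`; as curvature is a tensor, tangent vectors
may be extended to vector fields in any way, here by left translation. -/
def ricci [FiniteDimensional ℝ E] (g : TensorField02 I G) (x : G) (u v : TangentSpace I x) : ℝ :=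
  let b := Module.finBasis ℝ (TangentSpace I x)
  ∑ i, b.coord i (riemannCurvature g (leftExtend (b i)) (leftExtend u) (leftExtend v) x)

end LieGroupRicci

namespace SL2R

/-- The Lie algebra of `SL(2, ℝ)`: the tangent space at the identity, with the bracket of
left-invariant vector fields. -/
abbrev LieAlg : Type := GroupLieAlgebra 𝓘(ℝ, ℝ × ℝ × ℝ) SL2R

/-- Smooth Riemannian metrics on `SL(2, ℝ)`. -/
abbrev Metric : Type :=
  Bundle.ContMDiffRiemannianMetric 𝓘(ℝ, ℝ × ℝ × ℝ) ∞ (ℝ × ℝ × ℝ)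
    (fun x : SL2R => TangentSpace 𝓘(ℝ, ℝ × ℝ × ℝ) x)

/-- The Levi-Civita symbol on three indices. -/
def eps (i j k : Fin 3) : ℝ :=
  (((j : ℕ) : ℝ) - ((i : ℕ) : ℝ)) * (((k : ℕ) : ℝ) - ((i : ℕ) : ℝ))
    * (((k : ℕ) : ℝ) - ((j : ℕ) : ℝ)) / 2

/-- `[V_i, V_j] = ∑ k, ε_ijk λ_k V_k`. -/
def IsMilnorBasis (lam : Fin 3 → ℝ) (V : Module.Basis (Fin 3) ℝ LieAlg) : Prop :=
  ∀ i j, ⁅V i, V j⁆ = ∑ k, (eps i j k * lam k) • V k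

/-- `T = diag(t 0, t 1, t 2)` in the basis `V`. -/
def IsDiagIn (T : TensorField02 𝓘(ℝ, ℝ × ℝ × ℝ) SL2R) (V : Module.Basis (Fin 3) ℝ LieAlg)
    (t : Fin 3 → ℝ) : Prop :=
  ∀ i j, T 1 (V i) (V j) = if i = j then t i else 0

/-- `g` is a left-invariant Riemannian metric, `c > 0` and `Ric(g) = c T`. -/
def IsSolution (T : TensorField02 𝓘(ℝ, ℝ × ℝ × ℝ) SL2R) (g : Metric) (c : ℝ) : Prop :=
  TensorField02.IsLeftInvariant g.inner ∧ 0 < c ∧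
    ∀ (x : SL2R) (u v : TangentSpace 𝓘(ℝ, ℝ × ℝ × ℝ) x), ricci g.inner x u v = c * T x u v

/-- `g'` is a positive scalar multiple of `g`. -/
def SameUpToScaling (g g' : Metric) : Prop :=
  ∃ s : ℝ, 0 < s ∧ ∀ x, g'.inner x = s • g.inner x

/-- The sign and inequality conditions under which the solution is unique up to scaling. -/
def UniqueCase (t : Fin 3 → ℝ) : Prop :=
  (0 < t 0 ∧ t 1 < 0 ∧ t 2 < 0 ∧ -t 0 < t 2) ∨
  (0 < t 1 ∧ t 0 < 0 ∧ t 2 < 0 ∧ -t 1 < t 2) ∨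
  (t 0 < 0 ∧ t 1 < 0 ∧ 0 < t 2 ∧ max (-t 0) (-t 1) < t 2) ∨
  (t 0 < 0 ∧ t 1 < 0 ∧ 0 < t 2 ∧ t 2 < min (-t 0) (-t 1))

/-- The conditions under which there is a family of solutions with a common constant. -/
def FamilyCase (t : Fin 3 → ℝ) : Prop :=
  (t 0 = t 1 ∧ t 1 = -t 2 ∧ -t 2 < 0) ∨
  (t 0 < 0 ∧ t 1 = 0 ∧ t 2 = 0) ∨
  (t 1 < 0 ∧ t 0 = 0 ∧ t 2 = 0)

end SL2R

end

/-! A left-invariant tensor is determined by its value at the identity, so `Ric(g) = c T` is a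
question about bilinear forms on the Lie algebra. A scalar product and the Killing form `K` are
simultaneously diagonalizable, and since `K([u,v],w)` is alternating, a `K`-orthogonal basis becomes
a Milnor basis after rescaling and possibly a change of sign (`exists_isMilnorBasis_diagonal`). In
this basis the Ricci tensor of `diag(x, y, z)` is diagonal, so a solution also diagonalizes `T =
diag(A, B, C)`, and the equation becomes the system `DiagEq`.

Normalize `x + y + z = 1` and put `P = x - y - z`, `Q = y - x - z`, `τ = 2z`, so that `P + Q = -τ`.
The system reads `kAyz = 2P`, `kBxz = 2Q`, `kCxy = 2PQ`. The signs of `P`, `Q` and `x + y - z`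
dictate those of `A`, `B`, `C`, `A + C`, `B + C`, which yields the list of cases
(`uniqueCase_or_familyCase`). Eliminating `k` leaves the linear system `τAQ = C(1 + P)`, `τBP = C(1
+ Q)`; solving it and imposing `P + Q = -τ` gives the cubic `G(τ) = ABτ³ + C(A + B - C)τ + 2C² = 0`.
Conversely, a positive root with suitable signs gives a solution (`exists_of_root`). Such roots come
from the intermediate value theorem and values such as `G(1) = (A + C)(B + C)` and `G(-C/A) = C²(A +
C)(A - B)/A²`. In the unique cases only one root is admissible (`z_eq_of_mul_neg`, `z_eq_of_neg`).
In the family cases one of `P`, `Q`, `x + y - z` vanishes, which leaves a free parameter but fixes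
`k`.

Two solutions may a priori be diagonal in different Milnor bases. The operator relating `T` to `K`
has eigenvalues proportional to `t 0`, `t 1`, `-t 2`, and comparing its eigenvectors shows that in
the unique cases every solution is diagonal in the given basis (`UniqueCase.exists_isDiagIn`). In
the family cases comparing the diagonal entries suffices to determine `k`
(`mul_eq_neg_eight_of_familyCase`). -/

noncomputable section

/-! ### Left-invariant fields, tensors and curvature on a Lie group -/

section LeftInvariant

variable {E : Type*} [NormedAddCommGroup E] [NormedSpace ℝ E] {H : Type*} [TopologicalSpace H]
  {I : ModelWithCorners ℝ E H} {G : Type*} [TopologicalSpace G] [ChartedSpace H G] [Group G]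

theorem mdifferentiableAt_mul_left_infty [LieGroup I ∞ G] (a x : G) :
    MDifferentiableAt I I (fun y : G => a * y) x :=
  (contMDiff_mul_left (n := ∞)).contMDiffAt.mdifferentiableAt (by simp)

theorem mulInvariantVectorField_mul [LieGroup I ∞ G] (u : GroupLieAlgebra I G) (a x : G) :
    mulInvariantVectorField u (a * x) =
      mfderiv I I (fun y => a * y) x (mulInvariantVectorField u x) := by
  have h3 := mfderiv_comp (I := I) (I' := I) (I'' := I) 1 (g := fun y : G => a * y)
    (mdifferentiableAt_mul_left_infty a _) (mdifferentiableAt_mul_left_infty x 1)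
  have h4 : (fun y : G => a * y) ∘ (fun y : G => x * y) = fun y => a * x * y := by
    ext y; simp [mul_assoc]
  rw [h4] at h3
  have h5 := congrArg (fun L => L u) h3
  -- The equality `x * 1 = x` is only propositional, so the two derivatives are compared as maps of
  -- the model space.
  have h6 : ∀ z : G, z = x → ∀ w : E, (mfderiv I I (fun y : G => a * y) z : E → E) w =
      (mfderiv I I (fun y : G => a * y) x : E → E) w := by rintro z rfl w; rfl
  exact h5.trans (h6 _ (mul_one x) _)

theorem mulInvariantVectorField_one (u : GroupLieAlgebra I G) :
    mulInvariantVectorField u (1 : G) = u := by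
  have h4 : (fun y : G => 1 * y) = id := by ext y; simp
  have h7 : ∀ f : G → G, f = id → ∀ w : E, (mfderiv I I f 1 : E → E) w = w := by
    rintro f rfl w
    rw [mfderiv_id]
    rfl
  exact h7 _ h4 u

theorem leftExtend_mulInvariantVectorField [LieGroup I ∞ G] (u : GroupLieAlgebra I G) (x : G) :
    leftExtend (mulInvariantVectorField u x) = mulInvariantVectorField u := by
  have h := mulInvariantVectorField_mul u x⁻¹ x
  have h1 : ∀ z : G, z = 1 → (mulInvariantVectorField u z : E) = u := by
    rintro z rfl
    exact mulInvariantVectorField_one u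
  have h2 : (mfderiv I I (fun y => x⁻¹ * y) x (mulInvariantVectorField u x) : E) = u :=
    h.symm.trans (h1 _ (inv_mul_cancel x))
  exact congrArg (fun w : GroupLieAlgebra I G => mulInvariantVectorField w) h2

/-- Left translation of the Lie algebra to the tangent space at `x`, as a linear equivalence. -/
def leftTranslation (I : ModelWithCorners ℝ E H) [LieGroup I ∞ G] (x : G) :
    GroupLieAlgebra I G ≃ₗ[ℝ] TangentSpace I x :=
  { toFun := fun u => mulInvariantVectorField u x
    map_add' := fun u v => congrFun (mulInvariantVectorField_add u v) x
    map_smul' := fun c u => congrFun (mulInvariantVectorField_smul c u) x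
    invFun := fun u => leftExtend u 1
    left_inv := fun u => by
      simp only [leftExtend_mulInvariantVectorField, mulInvariantVectorField_one]
    right_inv := fun u => by
      have h : leftExtend u (1 : G) = _ := mulInvariantVectorField_one _
      simp only [h]
      exact leftExtend_apply_self u }

variable [LieGroup I ∞ G]

theorem leftTranslation_apply (x : G) (u : GroupLieAlgebra I G) :
    leftTranslation I x u = mulInvariantVectorField u x := rfl

theorem exists_mulInvariantVectorField_eq {x : G} (u : TangentSpace I x) :
    ∃ v : GroupLieAlgebra I G, mulInvariantVectorField v x = u :=
  (leftTranslation I x).surjective u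

theorem TensorField02.isLeftInvariant_iff {T : TensorField02 I G} :
    T.IsLeftInvariant ↔ ∀ (x : G) (u v : GroupLieAlgebra I G),
      T x (mulInvariantVectorField u x) (mulInvariantVectorField v x) = T 1 u v := by
  constructor
  · intro h x u v
    have h1 := h x 1 u v
    have h2 : ∀ z : G, z = x →
        T z (mulInvariantVectorField u z) (mulInvariantVectorField v z) =
        T x (mulInvariantVectorField u x) (mulInvariantVectorField v x) := by
      rintro z rfl; rfl
    rw [← h1, ← h2 _ (mul_one x), mulInvariantVectorField_mul, mulInvariantVectorField_mul,
      mulInvariantVectorField_one, mulInvariantVectorField_one]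
  · intro h a x u v
    obtain ⟨u, rfl⟩ := exists_mulInvariantVectorField_eq u
    obtain ⟨v, rfl⟩ := exists_mulInvariantVectorField_eq v
    rw [← mulInvariantVectorField_mul, ← mulInvariantVectorField_mul, h, h]

theorem TensorField02.IsLeftInvariant.ext {T T' : TensorField02 I G} (h : T.IsLeftInvariant)
    (h' : T'.IsLeftInvariant) (h1 : T 1 = T' 1) : T = T' := by
  funext x
  ext u v
  obtain ⟨u, rfl⟩ := exists_mulInvariantVectorField_eq u
  obtain ⟨v, rfl⟩ := exists_mulInvariantVectorField_eq v
  rw [isLeftInvariant_iff.1 h, isLeftInvariant_iff.1 h', h1]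

section Curvature

variable [LieGroup I (minSmoothness ℝ 3) G] [CompleteSpace E]

set_option linter.unusedSectionVars false
theorem mlieBracket_mulInvariantVectorField (u v : GroupLieAlgebra I G) :
    VectorField.mlieBracket I (mulInvariantVectorField u) (mulInvariantVectorField v) =
      mulInvariantVectorField (⁅u, v⁆ : GroupLieAlgebra I G) :=
  (mulInvariantVector_mlieBracket u v).symm

/-- Scalar products of left-invariant fields are constant functions, so only the bracket terms of
the Koszul formula survive. -/
theorem TensorField02.IsLeftInvariant.koszul_mulInvariantVectorField {g : TensorField02 I G}
    (hg : g.IsLeftInvariant) (u v w : GroupLieAlgebra I G) (x : G) :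
    koszul g (mulInvariantVectorField u) (mulInvariantVectorField v)
      (mulInvariantVectorField w) x = g 1 ⁅u, v⁆ w - g 1 ⁅u, w⁆ v - g 1 ⁅v, w⁆ u := by
  have hc : ∀ a : ℝ, mvfderiv I (fun _ : G => a) x = 0 := fun a => by
    ext w; simp [mvfderiv, mfderiv_const]
  simp only [koszul, mlieBracket_mulInvariantVectorField, isLeftInvariant_iff.1 hg, hc]
  simp

/-- `D` is the restriction of the Levi-Civita connection of the left-invariant metric with value
`B` at the identity to left-invariant vector fields. -/
def IsLeviCivitaAt (B : GroupLieAlgebra I G →L[ℝ] GroupLieAlgebra I G →L[ℝ] ℝ)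
    (D : GroupLieAlgebra I G →ₗ[ℝ] GroupLieAlgebra I G →ₗ[ℝ] GroupLieAlgebra I G) : Prop :=
  ∀ u v w, 2 * B (D u v) w = B ⁅u, v⁆ w - B ⁅u, w⁆ v - B ⁅v, w⁆ u

variable {g : TensorField02 I G}
  {D : GroupLieAlgebra I G →ₗ[ℝ] GroupLieAlgebra I G →ₗ[ℝ] GroupLieAlgebra I G}

/-- The field of `D u v` satisfies the equations defining `leviCivita`, so the vector chosen by
`epsilon` satisfies them too. Testing with the difference of the two and using positive definiteness
shows that they agree. -/
theorem TensorField02.IsLeftInvariant.leviCivita_mulInvariantVectorField (hg : g.IsLeftInvariant)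
    (hpos : ∀ x (u : TangentSpace I x), u ≠ 0 → 0 < g x u u) (hD : IsLeviCivitaAt (g 1) D)
    (u v : GroupLieAlgebra I G) :
    leviCivita g (mulInvariantVectorField u) (mulInvariantVectorField v) =
      mulInvariantVectorField (D u v) := by
  funext x
  have hex : ∃ z : TangentSpace I x, ∀ w : GroupLieAlgebra I G,
      2 * g x z (mulInvariantVectorField w x) = koszul g (mulInvariantVectorField u)
        (mulInvariantVectorField v) (mulInvariantVectorField w) x := by
    refine ⟨mulInvariantVectorField (D u v) x, fun w => ?_⟩
    rw [hg.koszul_mulInvariantVectorField, isLeftInvariant_iff.1 hg, hD]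
  have h := Classical.epsilon_spec hex
  change ∀ w, 2 * g x (leviCivita g (mulInvariantVectorField u) (mulInvariantVectorField v) x)
    (mulInvariantVectorField w x) = _ at h
  set z := leviCivita g (mulInvariantVectorField u) (mulInvariantVectorField v) x
  by_contra hne
  have hpos' := hpos x _ (sub_ne_zero.2 hne)
  obtain ⟨w, hw⟩ := exists_mulInvariantVectorField_eq (z - mulInvariantVectorField (D u v) x)
  have h1 := h w
  rw [hg.koszul_mulInvariantVectorField, ← hD, ← isLeftInvariant_iff.1 hg x (D u v) w, hw] at h1
  have h2 : ∀ a b c : TangentSpace I x, g x (a - b) c = g x a c - g x b c := fun a b c => by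
    rw [map_sub]; rfl
  rw [h2] at hpos'
  linarith

/-- The curvature of left-invariant vector fields, in terms of the connection `D`. -/
def curvatureAt
    (D : GroupLieAlgebra I G →ₗ[ℝ] GroupLieAlgebra I G →ₗ[ℝ] GroupLieAlgebra I G)
    (u v : GroupLieAlgebra I G) : GroupLieAlgebra I G →ₗ[ℝ] GroupLieAlgebra I G where
  toFun w := D w (D u v) - D u (D w v) - D ⁅w, u⁆ v
  map_add' w w' := by simp only [map_add, LinearMap.add_apply, add_lie]; abel
  map_smul' c w := by
    simp only [map_smul, LinearMap.smul_apply, smul_lie, RingHom.id_apply, smul_sub]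

theorem TensorField02.IsLeftInvariant.riemannCurvature_mulInvariantVectorField
    (hg : g.IsLeftInvariant)
    (hpos : ∀ x (u : TangentSpace I x), u ≠ 0 → 0 < g x u u) (hD : IsLeviCivitaAt (g 1) D)
    (u v w : GroupLieAlgebra I G) :
    riemannCurvature g (mulInvariantVectorField w) (mulInvariantVectorField u)
      (mulInvariantVectorField v) = mulInvariantVectorField (curvatureAt D u v w) := by
  funext x
  simp only [riemannCurvature, mlieBracket_mulInvariantVectorField,
    hg.leviCivita_mulInvariantVectorField hpos hD, Pi.sub_apply]
  simp only [← leftTranslation_apply, ← map_sub]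
  rfl

/-- Left translation conjugates the curvature endomorphism of the Lie algebra to the one at `x`, and
the trace is invariant under conjugation and change of basis. -/
theorem TensorField02.IsLeftInvariant.ricci_mulInvariantVectorField [FiniteDimensional ℝ E]
    (hg : g.IsLeftInvariant)
    (hpos : ∀ x (u : TangentSpace I x), u ≠ 0 → 0 < g x u u) (hD : IsLeviCivitaAt (g 1) D)
    (x : G) (u v : GroupLieAlgebra I G) :
    ricci g x (mulInvariantVectorField u x) (mulInvariantVectorField v x) =
      LinearMap.trace ℝ _ (curvatureAt D u v) := by
  have h : ∀ b : TangentSpace I x, riemannCurvature g (leftExtend b)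
      (leftExtend (mulInvariantVectorField u x)) (leftExtend (mulInvariantVectorField v x)) x =
      (leftTranslation I x).conj (curvatureAt D u v) b := by
    intro b
    obtain ⟨b, rfl⟩ := exists_mulInvariantVectorField_eq b
    simp only [leftExtend_mulInvariantVectorField,
      hg.riemannCurvature_mulInvariantVectorField hpos hD]
    rw [LinearEquiv.conj_apply_apply, ← leftTranslation_apply, ← leftTranslation_apply,
      LinearEquiv.symm_apply_apply]
  rw [← LinearMap.trace_conj' (curvatureAt D u v) (leftTranslation I x),
    LinearMap.trace_eq_matrix_trace ℝ (Module.finBasis ℝ (TangentSpace I x))]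
  simp only [ricci, h, Matrix.trace, Matrix.diag, LinearMap.toMatrix_apply, Module.Basis.coord_apply]

end Curvature

end LeftInvariant

/-! ### Left-invariant metrics from scalar products on the Lie algebra -/

section LeftInvariantMetric

theorem isVonNBounded_setOf_apply_self_lt_one {E : Type*} [NormedAddCommGroup E] [NormedSpace ℝ E]
    [FiniteDimensional ℝ E] (B : E →L[ℝ] E →L[ℝ] ℝ) (hpos : ∀ u, u ≠ 0 → 0 < B u u) :
    Bornology.IsVonNBounded ℝ {v : E | B v v < 1} := by
  obtain ⟨a, ha, hB⟩ := (isCompact_sphere (0 : E) 1).exists_forall_le' (f := fun v => B v v)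
    (a := 0) (by fun_prop) (fun v hv => hpos v (ne_zero_of_mem_unit_sphere ⟨v, hv⟩))
  rw [NormedSpace.isVonNBounded_iff, isBounded_iff_forall_norm_le]
  -- With `a` a positive lower bound on the unit sphere, `B v v ≥ a ‖v‖²`. The bound `1 + 1 / a`
  -- avoids a square root: beyond it `‖v‖ > 1` and `a ‖v‖ > 1`, hence `a ‖v‖² > 1`.
  refine ⟨1 + 1 / a, fun v hv => ?_⟩
  have hv : B v v < 1 := hv
  rcases eq_or_ne v 0 with rfl | h0
  · simp only [norm_zero]; positivity
  have hn : 0 < ‖v‖ := norm_pos_iff.2 h0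
  have h1 := hB (‖v‖⁻¹ • v) (by simp [norm_smul, hn.ne'])
  simp only [map_smul, smul_apply, smul_eq_mul] at h1
  have h2 : a * ‖v‖ ^ 2 ≤ B v v := by
    have h3 : ‖v‖ ^ 2 * (‖v‖⁻¹ * (‖v‖⁻¹ * B v v)) = B v v := by field_simp
    nlinarith [sq_nonneg ‖v‖]
  by_contra! h
  have h4 : 1 < a * ‖v‖ ^ 2 := by
    have h5 : 1 / a < ‖v‖ := by linarith
    have h6 : 1 < ‖v‖ * a := (div_lt_iff₀ ha).1 h5
    have h7 : 1 < ‖v‖ := by linarith [show (0 : ℝ) < 1 / a by positivity]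
    nlinarith
  linarith

set_option linter.unusedSectionVars false
variable {E : Type*} [NormedAddCommGroup E] [NormedSpace ℝ E] {H : Type*} [TopologicalSpace H]
  {I : ModelWithCorners ℝ E H} {G : Type*} [TopologicalSpace G] [ChartedSpace H G] [Group G]
  [LieGroup I ∞ G]

variable (I) in
/-- The left Maurer-Cartan form at `x`. -/
def maurerCartan (x : G) : E →L[ℝ] E :=
  (mfderiv I I (fun y => x⁻¹ * y) x : TangentSpace I x →L[ℝ] TangentSpace I (x⁻¹ * x))

theorem maurerCartan_mulInvariantVectorField (x : G) (u : GroupLieAlgebra I G) :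
    maurerCartan I x (mulInvariantVectorField u x) = u := by
  have h := mulInvariantVectorField_mul u x⁻¹ x
  have h1 : ∀ z : G, z = 1 → (mulInvariantVectorField u z : E) = u := by
    rintro z rfl
    exact mulInvariantVectorField_one u
  exact h.symm.trans (h1 _ (inv_mul_cancel x))

/-- The left-invariant tensor field with a given value at the identity. -/
def leftInvariantTensor (I : ModelWithCorners ℝ E H) (B : E →L[ℝ] E →L[ℝ] ℝ) :
    TensorField02 I G := fun x =>
  (B.bilinearComp (maurerCartan I x) (maurerCartan I x) : E →L[ℝ] E →L[ℝ] ℝ)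

theorem leftInvariantTensor_mulInvariantVectorField (B : E →L[ℝ] E →L[ℝ] ℝ) (x : G)
    (u v : GroupLieAlgebra I G) :
    leftInvariantTensor I B x (mulInvariantVectorField u x) (mulInvariantVectorField v x) =
      B u v :=
  congrArg₂ (fun u v : E => B u v) (maurerCartan_mulInvariantVectorField x u)
    (maurerCartan_mulInvariantVectorField x v)

theorem leftInvariantTensor_self_pos {B : E →L[ℝ] E →L[ℝ] ℝ} (hpos : ∀ u, u ≠ 0 → 0 < B u u)
    (x : G) (u : TangentSpace I x) (hu : u ≠ 0) : 0 < leftInvariantTensor I B x u u := by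
  obtain ⟨u, rfl⟩ := exists_mulInvariantVectorField_eq u
  rw [leftInvariantTensor_mulInvariantVectorField]
  refine hpos _ fun h => hu ?_
  rw [show u = 0 from h, ← leftTranslation_apply, map_zero]

/-- The form is the partial derivative of the smooth map `(x, y) ↦ x⁻¹ * y` in `y` at `y = x`, and
such derivatives depend smoothly on the parameter. -/
theorem contMDiffAt_maurerCartan [IsManifold I 1 G] (x₀ : G) :
    ContMDiffAt I 𝓘(ℝ, E →L[ℝ] E) ∞
      (fun x => maurerCartan I x ∘L
        (Bundle.Trivialization.symmL ℝ (trivializationAt E (TangentSpace I) x₀) x)) x₀ := by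
  have h := ContMDiffAt.mfderiv (m := ∞) (n := ∞) (I := I) (I' := I) (J := I) (x₀ := x₀)
    (fun x y : G => x⁻¹ * y) id
    ((contMDiff_fst.inv (n := ∞)).mul contMDiff_snd).contMDiffAt contMDiffAt_id (by simp)
  refine h.congr_of_eventuallyEq (Filter.Eventually.of_forall fun x => ?_)
  ext v
  simp [inTangentCoordinates, ContinuousLinearMap.inCoordinates]
  -- The values all lie over `x⁻¹ * x = 1`, where the trivialization centred at `1` is the identity.
  have h1 : ∀ z : G, z = 1 → ∀ w : E, (Bundle.Trivialization.continuousLinearMapAt ℝ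
      (trivializationAt E (TangentSpace I) (1 : G)) z : E →L[ℝ] E) w = w := by
    rintro z rfl w
    rw [TangentBundle.continuousLinearMapAt_trivializationAt_eq_core (mem_chart_source H _)]
    exact (tangentBundleCore I G).coordChange_self _ _ (mem_chart_source H _) _
  exact (h1 _ (inv_mul_cancel x) _).symm

/-- The left-invariant Riemannian metric with a given value at the identity. -/
def leftInvariantMetric [IsManifold I 1 G] [FiniteDimensional ℝ E]
    (B : E →L[ℝ] E →L[ℝ] ℝ) (hsymm : ∀ u v, B u v = B v u) (hpos : ∀ u, u ≠ 0 → 0 < B u u) :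
    Bundle.ContMDiffRiemannianMetric I ∞ E (fun x : G => TangentSpace I x) where
  inner := leftInvariantTensor I B
  symm x u v := hsymm _ _
  pos := leftInvariantTensor_self_pos hpos
  isVonNBounded x := by
    exact isVonNBounded_setOf_apply_self_lt_one (E := E) (leftInvariantTensor I B x)
      (leftInvariantTensor_self_pos hpos x)
  contMDiff := by
    intro x₀
    rw [contMDiffAt_hom_bundle]
    refine ⟨contMDiffAt_id, ?_⟩
    -- In the trivialization the metric is this quadratic function of the Maurer-Cartan form.
    have hΦ : ContDiff ℝ ∞ (fun L : E →L[ℝ] E => B.bilinearComp L L) := by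
      rw [contDiff_clm_apply_iff]
      intro u
      rw [contDiff_clm_apply_iff]
      intro v
      simp only [ContinuousLinearMap.bilinearComp_apply]
      fun_prop
    refine (hΦ.contMDiff.contMDiffAt.comp x₀ (contMDiffAt_maurerCartan x₀)).congr_of_eventuallyEq ?_
    filter_upwards [(trivializationAt E (TangentSpace I) x₀).open_baseSet.mem_nhds
      (FiberBundle.mem_baseSet_trivializationAt' x₀)] with x hx
    ext u v
    erw [inCoordinates_apply_eq₂ hx hx (by simp)]
    have hs := Bundle.Trivialization.symmL_apply (R := ℝ)
      (trivializationAt E (TangentSpace I) x₀) hx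
    refine Eq.trans ?_ (congrArg₂ (fun u v => leftInvariantTensor I B x u v) (hs u) (hs v)).symm
    simp

end LeftInvariantMetric

/-! ### Derivatives of charts in their own coordinates -/

section ChartDerivative

variable {E : Type*} [NormedAddCommGroup E] [NormedSpace ℝ E] {H : Type*} [TopologicalSpace H]
  {I : ModelWithCorners ℝ E H} {M : Type*} [TopologicalSpace M] [ChartedSpace H M]
  [IsManifold I 1 M]

/-- The tangent space at `x` is identified with `E` through the preferred chart at `x`, so that
chart has identity derivative there. -/
theorem mfderiv_extChartAt_of_chartAt_eq {x x₀ : M} (h : chartAt H x = chartAt H x₀) :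
    (mfderiv I 𝓘(ℝ, E) (extChartAt I x₀) x : E →L[ℝ] E) = ContinuousLinearMap.id ℝ E := by
  have hx : x ∈ (chartAt H x₀).source := h ▸ mem_chart_source H x
  have ha : achart H x = achart H x₀ := Subtype.ext h
  rw [← TangentBundle.continuousLinearMapAt_trivializationAt hx,
    TangentBundle.continuousLinearMapAt_trivializationAt_eq_core hx, ha]
  ext v
  exact (tangentBundleCore I M).coordChange_self _ _ hx _

theorem mfderivWithin_extChartAt_symm_of_chartAt_eq {x x₀ : M} (h : chartAt H x = chartAt H x₀) :
    (mfderivWithin 𝓘(ℝ, E) I (extChartAt I x₀).symm (Set.range I) (extChartAt I x₀ x) :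
      E →L[ℝ] E) = ContinuousLinearMap.id ℝ E := by
  have hx : x ∈ (chartAt H x₀).source := h ▸ mem_chart_source H x
  have ha : achart H x = achart H x₀ := Subtype.ext h
  have h1 := TangentBundle.symmL_trivializationAt (I := I) hx
  have h2 := TangentBundle.symmL_trivializationAt_eq_core (I := I) hx
  rw [ha] at h2
  refine Eq.trans (congrArg (fun L : E →L[ℝ] E => L) (h1.symm.trans h2)) ?_
  ext v
  exact (tangentBundleCore I M).coordChange_self _ _ hx _

end ChartDerivative

/-! ### The Lie bracket of SL(2) in coordinates -/

namespace SL2R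

theorem chartAt_eq_chartA {x : SL2R} (hx : entry 0 0 x ≠ 0) :
    chartAt (ℝ × ℝ × ℝ) x = chartA :=
  if_pos hx

theorem entry_zero_zero_one_ne : entry 0 0 (1 : SL2R) ≠ 0 := by simp [entry]

theorem chartA_one : chartA 1 = (1, 0, 0) := by
  simp [chartA, entry]

theorem entry_chartA_symm {p : ℝ × ℝ × ℝ} (hp : p.1 ≠ 0) :
    entry 0 0 (chartA.symm p) = p.1 ∧ entry 0 1 (chartA.symm p) = p.2.1 ∧
      entry 1 0 (chartA.symm p) = p.2.2 ∧
      entry 1 1 (chartA.symm p) = (1 + p.2.1 * p.2.2) / p.1 :=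
  entry_mk (by field_simp; ring)

/-- The lower right entry is determined by `det = 1`; its linearization at the identity is the
trace-zero condition. -/
theorem hasFDerivAt_entry_one_one :
    HasFDerivAt (fun p : ℝ × ℝ × ℝ => (1 + p.2.1 * p.2.2) / p.1)
      (-ContinuousLinearMap.fst ℝ ℝ (ℝ × ℝ)) (1, 0, 0) := by
  have h1 : HasFDerivAt (fun p : ℝ × ℝ × ℝ => p.1) (ContinuousLinearMap.fst ℝ ℝ (ℝ × ℝ))
    (1, 0, 0) := hasFDerivAt_fst
  have h2 : HasFDerivAt (fun p : ℝ × ℝ × ℝ => p.2.1) _ (1, 0, 0) :=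
    (hasFDerivAt_fst (𝕜 := ℝ)).comp _ hasFDerivAt_snd
  have h3 : HasFDerivAt (fun p : ℝ × ℝ × ℝ => p.2.2) _ (1, 0, 0) :=
    (hasFDerivAt_snd (𝕜 := ℝ)).comp _ hasFDerivAt_snd
  have h4 : HasFDerivAt (fun p : ℝ × ℝ × ℝ => (p.1)⁻¹) _ (1, 0, 0) :=
    (hasDerivAt_inv (one_ne_zero (α := ℝ))).comp_hasFDerivAt (1, 0, 0) h1
  refine HasFDerivAt.congr_fderiv (((h2.mul h3).const_add 1).mul h4) ?_
  ext <;> simp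

theorem entry_mul (i j : Fin 2) (x y : SL2R) :
    entry i j (x * y) = entry i 0 x * entry 0 j y + entry i 1 x * entry 1 j y := by
  simp [entry, Matrix.mul_apply, Fin.sum_univ_two]

/-- The coordinates `(a, b, c)` of `u` stand for the trace-free matrix `(a b; c -a)`; the value of
the field at `x` is the matrix product of `x` with it, read in `chartA`. -/
theorem mulInvariantVectorField_eq_of_entry_ne_zero (u : LieAlg) {x : SL2R}
    (hx : entry 0 0 x ≠ 0) :
    (mulInvariantVectorField u x : ℝ × ℝ × ℝ) =
      (entry 0 0 x * u.1 + entry 0 1 x * u.2.2,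
       entry 0 0 x * u.2.1 - entry 0 1 x * u.1,
       entry 1 0 x * u.1 + entry 1 1 x * u.2.2) := by
  have h1 := chartAt_eq_chartA entry_zero_zero_one_ne
  have h2 : chartAt (ℝ × ℝ × ℝ) (x * 1) = chartA := chartAt_eq_chartA (by rwa [mul_one])
  have hd := mdifferentiableAt_mul_left_infty (I := 𝓘(ℝ, ℝ × ℝ × ℝ)) x (1 : SL2R)
  have h := hd.mfderiv
  simp only [writtenInExtChartAt, extChartAt, h1, h2] at h
  obtain ⟨L, hf, hL⟩ : ∃ L : (ℝ × ℝ × ℝ) →L[ℝ] (ℝ × ℝ × ℝ),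
      HasFDerivAt (fun p : ℝ × ℝ × ℝ =>
      (entry 0 0 x * p.1 + entry 0 1 x * p.2.2,
       entry 0 0 x * p.2.1 + entry 0 1 x * ((1 + p.2.1 * p.2.2) / p.1),
       entry 1 0 x * p.1 + entry 1 1 x * p.2.2)) L (1, 0, 0) ∧
      ∀ w, L w = (entry 0 0 x * w.1 + entry 0 1 x * w.2.2,
       entry 0 0 x * w.2.1 - entry 0 1 x * w.1,
       entry 1 0 x * w.1 + entry 1 1 x * w.2.2) := by
    refine ⟨_, HasFDerivAt.prodMk (HasFDerivAt.add (hasFDerivAt_fst.const_mul _)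
      (((hasFDerivAt_snd (𝕜 := ℝ)).comp _ hasFDerivAt_snd).const_mul _))
    (HasFDerivAt.prodMk
      (HasFDerivAt.add (((hasFDerivAt_fst (𝕜 := ℝ)).comp _ hasFDerivAt_snd).const_mul _)
        (hasFDerivAt_entry_one_one.const_mul _))
      (HasFDerivAt.add (hasFDerivAt_fst.const_mul _)
        (((hasFDerivAt_snd (𝕜 := ℝ)).comp _ hasFDerivAt_snd).const_mul _))), fun w => ?_⟩
    simp
    ring
  have hev : (fun p : ℝ × ℝ × ℝ => chartA (x * chartA.symm p)) =ᶠ[nhds (1, 0, 0)] fun p =>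
      (entry 0 0 x * p.1 + entry 0 1 x * p.2.2,
       entry 0 0 x * p.2.1 + entry 0 1 x * ((1 + p.2.1 * p.2.2) / p.1),
       entry 1 0 x * p.1 + entry 1 1 x * p.2.2) := by
    filter_upwards [chartA.open_target.mem_nhds (show ((1, 0, 0) : ℝ × ℝ × ℝ) ∈ chartA.target from
      one_ne_zero (α := ℝ))] with p hp
    obtain ⟨e1, e2, e3, e4⟩ := entry_chartA_symm (p := p) hp
    show (entry 0 0 _, entry 0 1 _, entry 1 0 _) = _
    simp only [entry_mul, e1, e2, e3, e4]
  have hf' := hf.congr_of_eventuallyEq hev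
  refine (congrArg (fun L : (ℝ × ℝ × ℝ) →L[ℝ] (ℝ × ℝ × ℝ) => L u) h).trans ?_
  refine Eq.trans (b := fderivWithin ℝ (fun p : ℝ × ℝ × ℝ => chartA (x * chartA.symm p)) Set.univ
    (chartA 1) u) ?_ ?_
  · simp
    rfl
  · rw [fderivWithin_univ, chartA_one, hf'.fderiv]
    exact hL u

theorem hasFDerivAt_leftInvariant (u : LieAlg) : ∃ L : (ℝ × ℝ × ℝ) →L[ℝ] (ℝ × ℝ × ℝ),
    HasFDerivAt (fun p : ℝ × ℝ × ℝ => ((p.1 * u.1 + p.2.1 * u.2.2,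
       p.1 * u.2.1 - p.2.1 * u.1, p.2.2 * u.1 + ((1 + p.2.1 * p.2.2) / p.1) * u.2.2) :
        ℝ × ℝ × ℝ)) L (1, 0, 0) ∧
    ∀ w, L w = (u.1 * w.1 + u.2.2 * w.2.1, u.2.1 * w.1 - u.1 * w.2.1,
      u.1 * w.2.2 - u.2.2 * w.1) := by
  refine ⟨_, HasFDerivAt.prodMk (HasFDerivAt.add (hasFDerivAt_fst.mul_const _)
      (((hasFDerivAt_fst (𝕜 := ℝ)).comp _ hasFDerivAt_snd).mul_const _))
    (HasFDerivAt.prodMk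
      (HasFDerivAt.sub (hasFDerivAt_fst.mul_const _)
        (((hasFDerivAt_fst (𝕜 := ℝ)).comp _ hasFDerivAt_snd).mul_const _))
      (HasFDerivAt.add (((hasFDerivAt_snd (𝕜 := ℝ)).comp _ hasFDerivAt_snd).mul_const _)
        (hasFDerivAt_entry_one_one.mul_const _))), fun w => ?_⟩
  simp
  ring

/-- All points of the domain of `chartA` have the same preferred chart as the identity, so the
pullback involves only identity derivatives. -/
theorem mpullbackWithin_mulInvariantVectorField (u : LieAlg) {p : ℝ × ℝ × ℝ} (hp : p.1 ≠ 0) :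
    (VectorField.mpullbackWithin 𝓘(ℝ, ℝ × ℝ × ℝ) 𝓘(ℝ, ℝ × ℝ × ℝ)
      (extChartAt 𝓘(ℝ, ℝ × ℝ × ℝ) (1 : SL2R)).symm (mulInvariantVectorField u)
      (Set.range 𝓘(ℝ, ℝ × ℝ × ℝ)) p : ℝ × ℝ × ℝ) =
    (p.1 * u.1 + p.2.1 * u.2.2,
       p.1 * u.2.1 - p.2.1 * u.1, p.2.2 * u.1 + ((1 + p.2.1 * p.2.2) / p.1) * u.2.2) := by
  obtain ⟨e1, e2, e3, e4⟩ := entry_chartA_symm (p := p) hp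
  have h1 := chartAt_eq_chartA entry_zero_zero_one_ne
  have hs : ((extChartAt 𝓘(ℝ, ℝ × ℝ × ℝ) (1 : SL2R)).symm p) = chartA.symm p := by
    simp [extChartAt, h1]
  have hx : entry 0 0 (chartA.symm p) ≠ 0 := by rwa [e1]
  have hc := mfderivWithin_extChartAt_symm_of_chartAt_eq (I := 𝓘(ℝ, ℝ × ℝ × ℝ))
    ((chartAt_eq_chartA hx).trans h1.symm)
  have hp' : extChartAt 𝓘(ℝ, ℝ × ℝ × ℝ) (1 : SL2R) (chartA.symm p) = p := by
    simp only [extChartAt, h1]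
    exact chartA.right_inv hp
  rw [hp'] at hc
  rw [VectorField.mpullbackWithin_apply]
  refine (congrArg (fun L : (ℝ × ℝ × ℝ) →L[ℝ] (ℝ × ℝ × ℝ) => L.inverse (mulInvariantVectorField u
    ((extChartAt 𝓘(ℝ, ℝ × ℝ × ℝ) (1 : SL2R)).symm p) : ℝ × ℝ × ℝ)) hc).trans ?_
  rw [ContinuousLinearMap.inverse_id]
  rw [hs]
  refine (mulInvariantVectorField_eq_of_entry_ne_zero u hx).trans ?_
  rw [e1, e2, e3, e4]

/-- This is the commutator of trace-free matrices, obtained by differentiating the coordinate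
expressions of the left-invariant fields at the identity. -/
theorem bracket_eq (u v : LieAlg) : (⁅u, v⁆ : LieAlg) =
    ((u.2.1 * v.2.2 - u.2.2 * v.2.1, 2 * (u.1 * v.2.1 - u.2.1 * v.1),
      2 * (u.2.2 * v.1 - u.1 * v.2.2)) : ℝ × ℝ × ℝ) := by
  rw [GroupLieAlgebra.bracket_def, ← VectorField.mlieBracketWithin_univ,
    VectorField.mlieBracketWithin_apply]
  have h1 := chartAt_eq_chartA entry_zero_zero_one_ne
  have hc := mfderiv_extChartAt_of_chartAt_eq (I := 𝓘(ℝ, ℝ × ℝ × ℝ)) (x := (1 : SL2R)) rfl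
  refine (congrArg (fun L : (ℝ × ℝ × ℝ) →L[ℝ] (ℝ × ℝ × ℝ) => L.inverse _) hc).trans ?_
  rw [ContinuousLinearMap.inverse_id]
  have he : extChartAt 𝓘(ℝ, ℝ × ℝ × ℝ) (1 : SL2R) 1 = (1, 0, 0) := by
    simp only [extChartAt, h1]
    exact chartA_one
  have hev : ∀ u : LieAlg, (VectorField.mpullbackWithin 𝓘(ℝ, ℝ × ℝ × ℝ) 𝓘(ℝ, ℝ × ℝ × ℝ)
      (extChartAt 𝓘(ℝ, ℝ × ℝ × ℝ) (1 : SL2R)).symm (mulInvariantVectorField u)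
      (Set.range 𝓘(ℝ, ℝ × ℝ × ℝ)) : ℝ × ℝ × ℝ → ℝ × ℝ × ℝ) =ᶠ[nhds (1, 0, 0)] fun p =>
    (p.1 * u.1 + p.2.1 * u.2.2,
       p.1 * u.2.1 - p.2.1 * u.1, p.2.2 * u.1 + ((1 + p.2.1 * p.2.2) / p.1) * u.2.2) := by
    intro u
    filter_upwards [chartA.open_target.mem_nhds (show ((1, 0, 0) : ℝ × ℝ × ℝ) ∈ chartA.target from
      one_ne_zero (α := ℝ))] with p hp
    exact mpullbackWithin_mulInvariantVectorField u hp
  obtain ⟨L, hL, hLw⟩ := hasFDerivAt_leftInvariant u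
  obtain ⟨L', hL', hLw'⟩ := hasFDerivAt_leftInvariant v
  have hs : (extChartAt 𝓘(ℝ, ℝ × ℝ × ℝ) (1 : SL2R)).symm ⁻¹' Set.univ ∩
      Set.range 𝓘(ℝ, ℝ × ℝ × ℝ) = Set.univ := by simp
  rw [he, hs]
  have key : ∀ V W : ℝ × ℝ × ℝ → ℝ × ℝ × ℝ, HasFDerivAt V L (1, 0, 0) → HasFDerivAt W L' (1, 0, 0) →
      VectorField.lieBracketWithin ℝ V W Set.univ (1, 0, 0) = L' (V (1, 0, 0)) - L (W (1, 0, 0)) := by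
    intro V W hV hW
    rw [VectorField.lieBracketWithin_univ, VectorField.lieBracket, hV.fderiv, hW.fderiv]
  refine (key _ _ (hL.congr_of_eventuallyEq (hev u)) (hL'.congr_of_eventuallyEq (hev v))).trans ?_
  rw [(hev u).eq_of_nhds, (hev v).eq_of_nhds, hLw, hLw']
  ext <;> simp <;> ring

end SL2R

/-! ### Connection and Ricci curvature in a Milnor basis -/

namespace SL2R

/-- The Ricci curvature of the metric `diag(x 0, x 1, x 2)` in a Milnor basis. -/
def ricciDiag (x : Fin 3 → ℝ) : Fin 3 → ℝ :=
  ![2 * (x 0 ^ 2 - (x 1 + x 2) ^ 2) / (x 1 * x 2), 2 * (x 1 ^ 2 - (x 0 + x 2) ^ 2) / (x 0 * x 2),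
    2 * (x 2 ^ 2 - (x 0 - x 1) ^ 2) / (x 0 * x 1)]

/-- The Levi-Civita connection of the metric `diag(x 0, x 1, x 2)` in the Milnor basis `V`. -/
def milnorConnection (V : Module.Basis (Fin 3) ℝ LieAlg) (x : Fin 3 → ℝ) :
    LieAlg →ₗ[ℝ] LieAlg →ₗ[ℝ] LieAlg :=
  V.constr ℝ fun i => V.constr ℝ fun j => ∑ k, (eps i j k *
    (![2, 2, -2] k * x k + ![2, 2, -2] j * x j - ![2, 2, -2] i * x i) / (2 * x k)) • V k

theorem milnorConnection_basis (V : Module.Basis (Fin 3) ℝ LieAlg) (x : Fin 3 → ℝ) (i j : Fin 3) :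
    milnorConnection V x (V i) (V j) = ∑ k, (eps i j k *
    (![2, 2, -2] k * x k + ![2, 2, -2] j * x j - ![2, 2, -2] i * x i) / (2 * x k)) • V k := by
  simp [milnorConnection]

variable {V : Module.Basis (Fin 3) ℝ LieAlg} {x : Fin 3 → ℝ}

theorem eq_zero_of_isLinearMap₃ {M ι : Type*} [AddCommGroup M] [Module ℝ M]
    (b : Module.Basis ι ℝ M) {f : M → M → M → ℝ} (h₁ : ∀ v w, IsLinearMap ℝ fun u => f u v w)
    (h₂ : ∀ u w, IsLinearMap ℝ fun v => f u v w) (h₃ : ∀ u v, IsLinearMap ℝ fun w => f u v w)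
    (hb : ∀ i j k, f (b i) (b j) (b k) = 0) (u v w : M) : f u v w = 0 := by
  have key : ∀ φ : M → ℝ, IsLinearMap ℝ φ → (∀ i, φ (b i) = 0) → ∀ u, φ u = 0 :=
    fun φ hφ h0 u => LinearMap.congr_fun (b.ext (f₁ := hφ.mk' φ) (f₂ := 0) h0) u
  exact key _ (h₁ v w) (fun i => key _ (h₂ _ w) (fun j => key _ (h₃ _ _) (hb i j) w) v) u

/-- The Koszul identity is trilinear, so basis triples suffice. There the antisymmetry of `eps`
gives every bracket term the same factor `eps i j k`, up to sign. -/
theorem isLeviCivitaAt_milnorConnection (hV : IsMilnorBasis ![2, 2, -2] V)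
    {g : TensorField02 𝓘(ℝ, ℝ × ℝ × ℝ) SL2R} (hg : IsDiagIn g V x) (hx : ∀ i, 0 < x i) :
    IsLeviCivitaAt (g 1) (milnorConnection V x) := by
  intro u v w
  rw [← sub_eq_zero]
  have hl : ∀ a b c : LieAlg, g 1 (a + b) c = g 1 a c + g 1 b c := fun a b c => by
    rw [map_add]; rfl
  have hs : ∀ (r : ℝ) (a c : LieAlg), g 1 (r • a) c = r * g 1 a c := fun r a c => by
    rw [map_smul]; rfl
  refine eq_zero_of_isLinearMap₃ V (f := fun u v w => 2 * g 1 (milnorConnection V x u v) w -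
    (g 1 ⁅u, v⁆ w - g 1 ⁅u, w⁆ v - g 1 ⁅v, w⁆ u)) ?_ ?_ ?_ ?_ u v w
  · intro v w
    constructor
    · intro a b
      simp only [map_add, LinearMap.add_apply, add_lie, add_apply]
      ring
    · intro r a
      simp only [map_smul, LinearMap.smul_apply, smul_lie, smul_apply, smul_eq_mul]
      ring
  · intro v w
    constructor
    · intro a b
      simp only [map_add, add_lie, lie_add, add_apply]
      ring
    · intro r a
      simp only [map_smul, smul_lie, lie_smul, smul_apply, smul_eq_mul]
      ring
  · intro v w
    constructor
    · intro a b
      simp only [map_add, lie_add, add_apply]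
      ring
    · intro r a
      simp only [map_smul, lie_smul, smul_apply, smul_eq_mul]
      ring
  · intro i j k
    have h0 := (hx 0).ne'
    have h1 := (hx 1).ne'
    have h2 := (hx 2).ne'
    have hg' : ∀ i j, g 1 (V i) (V j) = if i = j then x i else 0 := hg
    simp only [milnorConnection_basis, hV i j, hV i k, hV j k, Fin.sum_univ_three, hl, hs, hg']
    fin_cases i <;> fin_cases j <;> fin_cases k <;> simp [eps] <;> field_simp <;> ring

theorem trace_curvatureAt_milnorConnection (hV : IsMilnorBasis ![2, 2, -2] V)
    (hx : ∀ i, 0 < x i) (i j : Fin 3) :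
    LinearMap.trace ℝ _ (curvatureAt (milnorConnection V x) (V i) (V j)) =
      if i = j then ricciDiag x i else 0 := by
  have h0 := (hx 0).ne'
  have h1 := (hx 1).ne'
  have h2 := (hx 2).ne'
  rw [LinearMap.trace_eq_matrix_trace ℝ V]
  have hR : ∀ k, curvatureAt (milnorConnection V x) (V i) (V j) (V k) =
      milnorConnection V x (V k) (milnorConnection V x (V i) (V j)) -
      milnorConnection V x (V i) (milnorConnection V x (V k) (V j)) -
      milnorConnection V x ⁅V k, V i⁆ (V j) := fun k => rfl
  simp only [Matrix.trace, Matrix.diag, LinearMap.toMatrix_apply, Fin.sum_univ_three, hR,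
    hV _ _, milnorConnection_basis, map_add, map_smul, map_sub, LinearMap.add_apply,
    LinearMap.smul_apply, Finsupp.add_apply, Finsupp.sub_apply, Finsupp.smul_apply,
    Module.Basis.repr_self]
  fin_cases i <;> fin_cases j <;> simp [eps, ricciDiag] <;> field_simp <;> ring

theorem ricci_of_isDiagIn (hV : IsMilnorBasis ![2, 2, -2] V) {g : Metric}
    (hg : TensorField02.IsLeftInvariant g.inner) (hd : IsDiagIn g.inner V x)
    (hx : ∀ i, 0 < x i) (y : SL2R) (i j : Fin 3) :
    ricci g.inner y (mulInvariantVectorField (V i) y) (mulInvariantVectorField (V j) y) =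
      if i = j then ricciDiag x i else 0 := by
  rw [hg.ricci_mulInvariantVectorField g.pos (isLeviCivitaAt_milnorConnection hV hd hx),
    trace_curvatureAt_milnorConnection hV hx]

end SL2R

/-! ### The algebraic system for diagonal metrics -/

namespace SL2R

/-- The prescribed Ricci curvature equations `Ric = k T` for the metric `diag(x, y, z)` and the
tensor `T = diag(A, B, C)` in a Milnor basis, with denominators cleared. -/
structure DiagEq (A B C k x y z : ℝ) : Prop where
  x_pos : 0 < x
  y_pos : 0 < y
  z_pos : 0 < z
  k_pos : 0 < k
  eq_A : k * A * (y * z) = 2 * (x ^ 2 - (y + z) ^ 2)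
  eq_B : k * B * (x * z) = 2 * (y ^ 2 - (x + z) ^ 2)
  eq_C : k * C * (x * y) = 2 * (z ^ 2 - (x - y) ^ 2)

namespace DiagEq

variable {A B C k k' x y z x' y' z' : ℝ}

theorem swap (h : DiagEq A B C k x y z) : DiagEq B A C k y x z where
  x_pos := h.y_pos
  y_pos := h.x_pos
  z_pos := h.z_pos
  k_pos := h.k_pos
  eq_A := h.eq_B
  eq_B := h.eq_A
  eq_C := by rw [mul_comm y x, h.eq_C]; ring

theorem smul (h : DiagEq A B C k x y z) {s : ℝ} (hs : 0 < s) :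
    DiagEq A B C k (s * x) (s * y) (s * z) where
  x_pos := mul_pos hs h.x_pos
  y_pos := mul_pos hs h.y_pos
  z_pos := mul_pos hs h.z_pos
  k_pos := h.k_pos
  eq_A := by linear_combination s ^ 2 * h.eq_A
  eq_B := by linear_combination s ^ 2 * h.eq_B
  eq_C := by linear_combination s ^ 2 * h.eq_C

/-- The right-hand side factors as `2 (x + y + z) (x - y - z)`, and the first factor is positive. -/
theorem A_pos_iff (h : DiagEq A B C k x y z) : 0 < A ↔ y + z < x := by
  obtain ⟨hx, hy, hz, hk, hA, -, -⟩ := h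
  have h1 : (k * (y * z)) * A = (2 * (x + y + z)) * (x - y - z) := by linear_combination hA
  rw [← mul_pos_iff_of_pos_left (show 0 < k * (y * z) by positivity), h1,
    mul_pos_iff_of_pos_left (by positivity)]
  constructor <;> intro <;> linarith

theorem A_neg_iff (h : DiagEq A B C k x y z) : A < 0 ↔ x < y + z := by
  obtain ⟨hx, hy, hz, hk, hA, -, -⟩ := h
  have h1 : (k * (y * z)) * (-A) = (2 * (x + y + z)) * (y + z - x) := by linear_combination -hA
  rw [← neg_pos, ← mul_pos_iff_of_pos_left (show 0 < k * (y * z) by positivity), h1,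
    mul_pos_iff_of_pos_left (by positivity)]
  constructor <;> intro <;> linarith

theorem A_eq_zero_iff (h : DiagEq A B C k x y z) : A = 0 ↔ x = y + z := by
  rcases lt_trichotomy x (y + z) with h1 | h1 | h1
  · exact ⟨fun h2 => absurd (h.A_neg_iff.2 h1) (by simp [h2]), fun h2 => absurd h2 h1.ne⟩
  · refine ⟨fun _ => h1, fun _ => ?_⟩
    exact le_antisymm (not_lt.1 fun h2 => (h.A_pos_iff.1 h2).ne' h1)
      (not_lt.1 fun h2 => (h.A_neg_iff.1 h2).ne h1)
  · exact ⟨fun h2 => absurd (h.A_pos_iff.2 h1) (by simp [h2]), fun h2 => absurd h2 h1.ne'⟩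

theorem eq_A_add_C (h : DiagEq A B C k x y z) :
    k * (x * y * z) * (A + C) = 2 * (x - y - z) * ((x + z) * (x + y - z)) := by
  linear_combination x * h.eq_A + z * h.eq_C

theorem C_mul_eq (h : DiagEq A B C k x y z) :
    k * (x * y) * C = 2 * ((x - y - z) * (y - x - z)) := by
  linear_combination h.eq_C

/-- When `x = y + z`, the factors `y - x - z` and `x + y + z` become `-2z` and `2x`, so `x z`
cancels from `eq_B`. -/
theorem mul_eq_neg_eight_of_eq_add (h : DiagEq A B C k x y z) (hx : x = y + z) : k * B = -8 := by
  have h0 := mul_pos h.x_pos h.z_pos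
  refine mul_right_cancel₀ h0.ne' ?_
  have := h.eq_B
  subst hx
  linear_combination this

/-- One of the factors in `eq_A_add_C` must vanish; `A ≠ 0` excludes `x - y - z`, so `z = x + y`. -/
theorem mul_eq_neg_eight_of_add_eq_zero (h : DiagEq A B C k x y z) (hA : A ≠ 0) (hAC : A + C = 0) :
    k * A = -8 := by
  have h1 := h.eq_A_add_C
  have h2 : x - y - z ≠ 0 := fun h2 => hA (h.A_eq_zero_iff.2 (by linarith))
  have h3 := h.x_pos
  have h4 := h.z_pos
  have h5 : x + z ≠ 0 := by positivity
  rw [hAC, mul_zero, eq_comm] at h1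
  have h6 : x + y - z = 0 := by
    simpa [h2, h5] using h1
  obtain rfl : z = x + y := by linarith
  refine mul_right_cancel₀ (mul_pos h.y_pos h.z_pos).ne' ?_
  linear_combination h.eq_A

theorem normalize (h : DiagEq A B C k x y z) : ∃ s x' y' z', 0 < s ∧ DiagEq A B C k x' y' z' ∧
    x' + y' + z' = 1 ∧ x = s * x' ∧ y = s * y' ∧ z = s * z' := by
  have hx := h.x_pos
  have hy := h.y_pos
  have hz := h.z_pos
  have hs : 0 < x + y + z := by positivity
  refine ⟨x + y + z, _, _, _, hs, h.smul (inv_pos.2 hs), ?_, ?_, ?_, ?_⟩ <;> field_simp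

section Normalized

/-- Multiplying `kAyz = 2P` by `Q` gives `2PQ = kCxy`, and `k y` cancels. -/
theorem two_z_mul_A (h : DiagEq A B C k x y z) (hs : x + y + z = 1) :
    2 * z * A * (y - x - z) = C * (2 * x) := by
  have h0 := (mul_pos h.k_pos h.y_pos).ne'
  refine mul_left_cancel₀ h0 ?_
  have e1 : k * A * (y * z) = 2 * (x - y - z) := by
    rw [h.eq_A]; linear_combination 2 * (x - y - z) * hs
  linear_combination 2 * (y - x - z) * e1 - 2 * h.eq_C

/-- Cramer's rule for the linear system in `P`, `Q` consisting of `two_z_mul_A` and its swap, with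
`2x = 1 + P` and `2y = 1 + Q`. -/
theorem det_mul_P (h : DiagEq A B C k x y z) (hs : x + y + z = 1) :
    (C ^ 2 - (2 * z) ^ 2 * A * B) * (x - y - z) = -C * (C + 2 * z * A) := by
  have h1 := h.two_z_mul_A hs
  have h2 := h.swap.two_z_mul_A (by linarith)
  obtain rfl : x = 1 - y - z := by linarith
  linear_combination (-C) * h1 - 2 * z * A * h2

/-- Adding the Cramer formulas for `P` and `Q` and using `P + Q = -2z` eliminates `x` and `y`. -/
theorem cubic (h : DiagEq A B C k x y z) (hs : x + y + z = 1) :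
    A * B * (2 * z) ^ 3 + C * (A + B - C) * (2 * z) + 2 * C ^ 2 = 0 := by
  have h1 := h.det_mul_P hs
  have h2 := h.swap.det_mul_P (by linarith)
  linear_combination h1 + h2

/-- A vanishing determinant forces `C + 2zA = 0` by `det_mul_P`; then `two_z_mul_A` gives `2z = 1`,
hence `A + C = 0`. -/
theorem det_ne_zero (h : DiagEq A B C k x y z) (hs : x + y + z = 1) (hC : C ≠ 0)
    (hAC : A + C ≠ 0) : C ^ 2 - (2 * z) ^ 2 * A * B ≠ 0 := by
  intro h0
  have h1 := h.det_mul_P hs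
  have h3 := h.two_z_mul_A hs
  rw [h0, zero_mul, zero_eq_mul] at h1
  have h2 := h1.resolve_left (neg_ne_zero.2 hC)
  have h4 : C * (2 * z - 1) = 0 := by
    obtain rfl : x = 1 - y - z := by linarith
    linear_combination (-2 * y + 1) * h2 + h3
  have h5 : 2 * z = 1 := by linarith [(mul_eq_zero.1 h4).resolve_left hC]
  rw [h5] at h2
  exact hAC (by linarith)

theorem eq_of_z_eq (h : DiagEq A B C k x y z) (hs : x + y + z = 1) (h' : DiagEq A B C k' x' y' z')
    (hs' : x' + y' + z' = 1) (hA : A ≠ 0) (hC : C ≠ 0) (hAC : A + C ≠ 0) (hz : z' = z) :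
    k' = k ∧ x' = x ∧ y' = y := by
  subst hz
  have h1 := h.det_mul_P hs
  have h2 := h'.det_mul_P hs'
  have h3 := mul_left_cancel₀ (h.det_ne_zero hs hC hAC) (h1.trans h2.symm)
  obtain rfl : x' = x := by linarith
  obtain rfl : y' = y := by linarith
  refine ⟨?_, rfl, rfl⟩
  have h4 : A * (y' * z') ≠ 0 := mul_ne_zero hA (mul_pos h.y_pos h.z_pos).ne'
  refine mul_right_cancel₀ h4 ?_
  linear_combination h'.eq_A - h.eq_A

/-- Here `P` and `Q` are negative, and the sign passes from `A + C` to `2z - 1` by `eq_A_add_C`,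
then to the determinant, then to `C + 2zA` by `det_mul_P`. -/
theorem sign_of_neg (h : DiagEq A B C k x y z) (hs : x + y + z = 1) (hA : A < 0) (hB : B < 0)
    (hC : 0 < C) :
    (0 < A + C → 0 < C + 2 * z * A) ∧ (A + C < 0 → C + 2 * z * A < 0) := by
  have hP : x - y - z < 0 := by linarith [h.A_neg_iff.1 hA]
  have hQ : y - x - z < 0 := by linarith [h.swap.A_neg_iff.1 hB]
  have hx := h.x_pos
  have hy := h.y_pos
  have hz := h.z_pos
  have hk := h.k_pos
  have h1 := h.two_z_mul_A hs
  have h2 := h.swap.two_z_mul_A (by linarith)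
  -- Multiply the two linear relations and use `(1 + P)(1 + Q) = 1 - 2z + PQ`.
  have h3 : (x - y - z) * (y - x - z) * (C ^ 2 - (2 * z) ^ 2 * A * B) = C ^ 2 * (2 * z - 1) := by
    obtain rfl : x = 1 - y - z := by linarith
    linear_combination (-(2 * z * B * (1 - y - z - y - z))) * h1 - C * (2 * (1 - y - z)) * h2
  have h4 := h.det_mul_P hs
  have h5 := h.eq_A_add_C
  have hPQ : 0 < (x - y - z) * (y - x - z) := mul_pos_of_neg_of_neg hP hQ
  have h6 : x + y - z = 1 - 2 * z := by linarith
  rw [h6] at h5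
  constructor
  · intro hAC
    have h7 : 0 < 2 * z - 1 := by
      by_contra hcon
      have : 0 < k * (x * y * z) * (A + C) := by positivity
      have : 0 ≤ (x + z) * (1 - 2 * z) := mul_nonneg (by positivity) (by linarith)
      nlinarith
    have h8 : 0 < C ^ 2 - (2 * z) ^ 2 * A * B :=
      (mul_pos_iff_of_pos_left hPQ).1 (h3 ▸ by positivity)
    refine (mul_pos_iff_of_pos_left hC).1 ?_
    nlinarith
  · intro hAC
    have h7 : 2 * z - 1 < 0 := by
      by_contra hcon
      have : 0 < k * (x * y * z) * (-(A + C)) := mul_pos (by positivity) (by linarith)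
      have : 0 ≤ (x + z) * (2 * z - 1) := mul_nonneg (by positivity) (by linarith)
      nlinarith
    have h8 : 0 < -(C ^ 2 - (2 * z) ^ 2 * A * B) := by
      refine (mul_pos_iff_of_pos_left hPQ).1 ?_
      have : 0 < C ^ 2 * (1 - 2 * z) := mul_pos (by positivity) (by linarith)
      linarith
    have h9 : 0 < C * (-(C + 2 * z * A)) := by nlinarith
    have := (mul_pos_iff_of_pos_left hC).1 h9
    linarith

/-- Distinct roots `s`, `t` of the cubic satisfy `A B s t (s + t) = 2 C²`, impossible for positive
roots when `A B < 0`. -/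
theorem z_eq_of_mul_neg (h : DiagEq A B C k x y z) (hs : x + y + z = 1)
    (h' : DiagEq A B C k' x' y' z') (hs' : x' + y' + z' = 1) (hAB : A * B < 0) (hC : C ≠ 0) :
    z' = z := by
  have h1 := h.cubic hs
  have h2 := h'.cubic hs'
  have h3 : (z' - z) * (A * B * ((2 * z) * (2 * z') * (2 * z + 2 * z')) - 2 * C ^ 2) = 0 := by
    linear_combination z * h2 - z' * h1
  have hz := h.z_pos
  have hz' := h'.z_pos
  have h4 : 0 < (2 * z) * (2 * z') * (2 * z + 2 * z') := by positivity
  have h5 : 0 < C ^ 2 := by positivity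
  have h6 : A * B * ((2 * z) * (2 * z') * (2 * z + 2 * z')) < 0 := mul_neg_of_neg_of_pos hAB h4
  have := (mul_eq_zero.1 h3).resolve_right (by linarith)
  linarith

/-- The cubic has no quadratic term, so its third root is `-(s + t)`. Evaluating its factorization
at `-C / A` gives the identity, up to the factor `-A²`. -/
theorem root_identity {A B C s t : ℝ} (hs : A * B * s ^ 3 + C * (A + B - C) * s + 2 * C ^ 2 = 0)
    (ht : A * B * t ^ 3 + C * (A + B - C) * t + 2 * C ^ 2 = 0) (hst : s ≠ t) :
    B * ((C + s * A) * (C + t * A) * (C - A * (s + t))) = -(C ^ 2 * (A + C) * (A - B)) := by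
  have h1 : A * B * (s ^ 2 + s * t + t ^ 2) = -(C * (A + B - C)) := by
    refine mul_left_cancel₀ (sub_ne_zero.2 hst) ?_
    linear_combination hs - ht
  have h2 : A * B * (s * t * (s + t)) = 2 * C ^ 2 := by
    refine mul_left_cancel₀ (sub_ne_zero.2 hst) ?_
    linear_combination t * hs - s * ht
  linear_combination (-A * C) * h1 - A ^ 2 * h2

/-- For two distinct roots, `sign_of_neg` makes the product in `root_identity` positive, so `(A +
C)(A - B) > 0`. The swapped identity gives `(B + C)(B - A) > 0`, a contradiction because `A + C` and
`B + C` have the same sign. -/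
theorem z_eq_of_neg (h : DiagEq A B C k x y z) (hs : x + y + z = 1)
    (h' : DiagEq A B C k' x' y' z') (hs' : x' + y' + z' = 1) (hA : A < 0) (hB : B < 0)
    (hC : 0 < C) (hABC : 0 < (A + C) * (B + C)) : z' = z := by
  by_contra hne
  have hne : 2 * z ≠ 2 * z' := fun h => hne (by linarith)
  have h1 := root_identity (h.cubic hs) (h'.cubic hs') hne
  have h2 := root_identity (h.swap.cubic (by linarith)) (h'.swap.cubic (by linarith)) hne
  have hz := h.z_pos
  have hz' := h'.z_pos
  have h3 : 0 < C - A * (2 * z + 2 * z') := by nlinarith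
  have h4 : 0 < C - B * (2 * z + 2 * z') := by nlinarith
  have s1 := h.sign_of_neg hs hA hB hC
  have s2 := h'.sign_of_neg hs' hA hB hC
  have s3 := h.swap.sign_of_neg (by linarith) hB hA hC
  have s4 := h'.swap.sign_of_neg (by linarith) hB hA hC
  have hCC : 0 < C ^ 2 := by positivity
  rcases mul_pos_iff.1 hABC with ⟨ha, hb⟩ | ⟨ha, hb⟩
  · have e1 := mul_pos (mul_pos (s1.1 ha) (s2.1 ha)) h3
    have e2 := mul_pos (mul_pos (s3.1 hb) (s4.1 hb)) h4
    have f1 : 0 < (C ^ 2 * (A + C)) * (A - B) := by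
      have := mul_neg_of_neg_of_pos hB e1
      linarith
    have f2 : 0 < (C ^ 2 * (B + C)) * (B - A) := by
      have := mul_neg_of_neg_of_pos hA e2
      linarith
    have g1 := (mul_pos_iff_of_pos_left (mul_pos hCC ha)).1 f1
    have g2 := (mul_pos_iff_of_pos_left (mul_pos hCC hb)).1 f2
    linarith
  · have e1 := mul_pos (mul_pos_of_neg_of_neg (s1.2 ha) (s2.2 ha)) h3
    have e2 := mul_pos (mul_pos_of_neg_of_neg (s3.2 hb) (s4.2 hb)) h4
    have f1 : 0 < (C ^ 2 * (-(A + C))) * (B - A) := by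
      have := mul_neg_of_neg_of_pos hB e1
      linarith
    have f2 : 0 < (C ^ 2 * (-(B + C))) * (A - B) := by
      have := mul_neg_of_neg_of_pos hA e2
      linarith
    have g1 := (mul_pos_iff_of_pos_left (mul_pos hCC (neg_pos.2 ha))).1 f1
    have g2 := (mul_pos_iff_of_pos_left (mul_pos hCC (neg_pos.2 hb))).1 f2
    linarith

end Normalized

/-- This inverts the substitution for `P`, `Q`, `τ`; the constant is read off from `kCxy = 2PQ`. -/
theorem of_root {τ P Q : ℝ} (hτ : 0 < τ) (hC : C ≠ 0) (hPQ : P + Q = -τ)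
    (h1 : τ * A * Q = C * (1 + P)) (h2 : τ * B * P = C * (1 + Q)) (hP : 0 < 1 + P)
    (hQ : 0 < 1 + Q) (hk : 0 < P * Q / C) :
    DiagEq A B C (8 * (P * Q / C) / ((1 + P) * (1 + Q))) ((1 + P) / 2) ((1 + Q) / 2) (τ / 2) where
  x_pos := by positivity
  y_pos := by positivity
  z_pos := by positivity
  k_pos := by positivity
  eq_A := by
    have : 2 * (((1 + P) / 2) ^ 2 - ((1 + Q) / 2 + τ / 2) ^ 2) = 2 * P := by
      obtain rfl : τ = -(P + Q) := by linarith
      ring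
    rw [this]
    field_simp
    linear_combination 8 * P * h1
  eq_B := by
    have : 2 * (((1 + Q) / 2) ^ 2 - ((1 + P) / 2 + τ / 2) ^ 2) = 2 * Q := by
      obtain rfl : τ = -(P + Q) := by linarith
      ring
    rw [this]
    field_simp
    linear_combination 8 * Q * h2
  eq_C := by
    obtain rfl : τ = -(P + Q) := by linarith
    field_simp
    ring

/-- Cramer's rule defines `P` and `Q`, and the cubic says `P + Q = -τ`. Positivity of `x` and `y`
follows from `1 + P = τ (AQ / C)` and `1 + Q = τ (BP / C)`; that of `k` follows from the product of
these quotients and `0 < A * B * C`. -/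
theorem exists_of_root {τ : ℝ} (hτ : 0 < τ) (hC : C ≠ 0)
    (hdet : C ^ 2 - τ ^ 2 * A * B ≠ 0)
    (hG : A * B * τ ^ 3 + C * (A + B - C) * τ + 2 * C ^ 2 = 0)
    (hP : 0 < B * (-C * (C + τ * A) / (C ^ 2 - τ ^ 2 * A * B)) / C)
    (hQ : 0 < A * (-C * (C + τ * B) / (C ^ 2 - τ ^ 2 * A * B)) / C)
    (hPQ : 0 < A * B * C) :
    ∃ k x y z, DiagEq A B C k x y z := by
  set P := -C * (C + τ * A) / (C ^ 2 - τ ^ 2 * A * B) with hPdef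
  set Q := -C * (C + τ * B) / (C ^ 2 - τ ^ 2 * A * B) with hQdef
  have e1 : (C ^ 2 - τ ^ 2 * A * B) * P = -C * (C + τ * A) := by rw [hPdef]; field_simp
  have e2 : (C ^ 2 - τ ^ 2 * A * B) * Q = -C * (C + τ * B) := by rw [hQdef]; field_simp
  have h1 : τ * A * Q = C * (1 + P) := by
    refine mul_left_cancel₀ hdet ?_
    linear_combination τ * A * e2 - C * e1
  have h2 : τ * B * P = C * (1 + Q) := by
    refine mul_left_cancel₀ hdet ?_
    linear_combination τ * B * e1 - C * e2
  have h3 : P + Q = -τ := by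
    refine mul_left_cancel₀ hdet ?_
    linear_combination e1 + e2 + (-1) * hG
  refine ⟨_, _, _, _, of_root hτ hC h3 h1 h2 ?_ ?_ ?_⟩
  · have : 1 + P = τ * (A * Q / C) := by field_simp; linarith
    rw [this]; positivity
  · have : 1 + Q = τ * (B * P / C) := by field_simp; linarith
    rw [this]; positivity
  · have h4 : 0 < (B * P / C) * (A * Q / C) := mul_pos hP hQ
    have h5 : (B * P / C) * (A * Q / C) * C ^ 2 = (A * B * C) * (P * Q / C) := by field_simp
    have h6 : 0 < (B * P / C) * (A * Q / C) * C ^ 2 := by positivity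
    rw [h5] at h6
    exact (mul_pos_iff_of_pos_left hPQ).1 h6

theorem exists_root_Ioo {f : ℝ → ℝ} (hf : Continuous f) {a b : ℝ} (hab : a < b)
    (h : f a * f b < 0) : ∃ τ, a < τ ∧ τ < b ∧ f τ = 0 := by
  rcases mul_neg_iff.1 h with ⟨ha, hb⟩ | ⟨ha, hb⟩
  · obtain ⟨τ, hτ, h0⟩ := intermediate_value_Ioo' hab.le hf.continuousOn ⟨hb, ha⟩
    exact ⟨τ, hτ.1, hτ.2, h0⟩
  · obtain ⟨τ, hτ, h0⟩ := intermediate_value_Ioo hab.le hf.continuousOn ⟨ha, hb⟩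
    exact ⟨τ, hτ.1, hτ.2, h0⟩

/-- The determinant is automatically positive since `A B < 0`; the remaining requirement is `C + τ A
> 0`, so a root is sought to the right of `-C / A`. -/
theorem exists_of_pos_neg_neg (hA : 0 < A) (hB : B < 0) (hC : C < 0) (hAC : 0 < A + C) :
    ∃ k x y z, DiagEq A B C k x y z := by
  have hC0 := hC.ne
  obtain ⟨τ, h1, h2, h3⟩ := exists_root_Ioo
    (f := fun τ => A * B * τ ^ 3 + C * (A + B - C) * τ + 2 * C ^ 2) (by fun_prop)
    (a := -C / A) (b := 2) (by rw [div_lt_iff₀ hA]; linarith) (by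
      have e1 : A * B * (-C / A) ^ 3 + C * (A + B - C) * (-C / A) + 2 * C ^ 2 =
        C ^ 2 / A ^ 2 * ((A + C) * (A - B)) := by field_simp; ring
      have e2 : A * B * 2 ^ 3 + C * (A + B - C) * 2 + 2 * C ^ 2 < 0 := by nlinarith
      rw [e1]
      exact mul_neg_of_pos_of_neg (mul_pos (div_pos (sq_pos_of_neg hC) (by positivity))
        (mul_pos hAC (by linarith))) e2)
  rw [div_lt_iff₀ hA] at h1
  have hτ : 0 < τ := by nlinarith
  have hdet0 : 0 < C ^ 2 - τ ^ 2 * A * B := by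
    have : 0 < τ ^ 2 * A * (-B) := mul_pos (by positivity) (by linarith)
    nlinarith
  obtain ⟨d, hd, hdet⟩ : ∃ d, d = C ^ 2 - τ ^ 2 * A * B ∧ 0 < d := ⟨_, rfl, hdet0⟩
  refine exists_of_root hτ hC.ne hdet0.ne' h3 ?_ ?_ ?_ <;> try rw [← hd]
  · have : B * (-C * (C + τ * A) / d) / C =
      -B * (C + τ * A) / d := by field_simp
    rw [this]
    exact div_pos (mul_pos (by linarith) (by linarith)) hdet
  · have : A * (-C * (C + τ * B) / d) / C =
      A * (-C + τ * (-B)) / d := by field_simp; ring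
    rw [this]
    have := mul_pos hτ (neg_pos.2 hB)
    exact div_pos (mul_pos hA (by linarith)) hdet
  · exact mul_pos_of_neg_of_neg (mul_neg_of_pos_of_neg hA hB) hC

/-- If `C + τ A` and `C + τ B` have a common sign, comparing `C²` with `(τ A)(τ B)` shows that the
determinant has it too. -/
theorem exists_of_neg_neg_pos_of_root (hA : A < 0) (hB : B < 0) (hC : 0 < C) {τ : ℝ} (hτ : 0 < τ)
    (hG : A * B * τ ^ 3 + C * (A + B - C) * τ + 2 * C ^ 2 = 0)
    (h : (0 < C + τ * A ∧ 0 < C + τ * B) ∨ (C + τ * A < 0 ∧ C + τ * B < 0)) :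
    ∃ k x y z, DiagEq A B C k x y z := by
  have e1 : B * (-C * (C + τ * A) / (C ^ 2 - τ ^ 2 * A * B)) / C =
      -B * ((C + τ * A) / (C ^ 2 - τ ^ 2 * A * B)) := by field_simp
  have e2 : A * (-C * (C + τ * B) / (C ^ 2 - τ ^ 2 * A * B)) / C =
      -A * ((C + τ * B) / (C ^ 2 - τ ^ 2 * A * B)) := by field_simp
  have hABC : 0 < A * B * C := mul_pos (mul_pos_of_neg_of_neg hA hB) hC
  have hτA := mul_neg_of_pos_of_neg hτ hA
  have hτB := mul_neg_of_pos_of_neg hτ hB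
  rcases h with ⟨ha, hb⟩ | ⟨ha, hb⟩
  · have hdet : 0 < C ^ 2 - τ ^ 2 * A * B := by nlinarith
    refine exists_of_root hτ hC.ne' hdet.ne' hG ?_ ?_ hABC
    · rw [e1]
      exact mul_pos (neg_pos.2 hB) (div_pos ha hdet)
    · rw [e2]
      exact mul_pos (neg_pos.2 hA) (div_pos hb hdet)
  · have hdet : C ^ 2 - τ ^ 2 * A * B < 0 := by nlinarith
    refine exists_of_root hτ hC.ne' hdet.ne hG ?_ ?_ hABC
    · rw [e1]
      exact mul_pos (neg_pos.2 hB) (div_pos_of_neg_of_neg ha hdet)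
    · rw [e2]
      exact mul_pos (neg_pos.2 hA) (div_pos_of_neg_of_neg hb hdet)

theorem exists_of_neg_neg_pos_of_le (hA : A < 0) (hB : B < 0) (hC : 0 < C) (hAB : A ≤ B)
    (h : (0 < A + C ∧ 0 < B + C) ∨ (A + C < 0 ∧ B + C < 0)) :
    ∃ k x y z, DiagEq A B C k x y z := by
  have hA0 := hA.ne
  have hB0 := hB.ne
  rcases hAB.eq_or_lt with rfl | hAB
  -- For `A = B` the cubic has the inadmissible root `-C / A`. The root is taken from the quadratic
  -- cofactor instead, on the side of `-C / A` given by the sign of `A + C`.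
  · obtain ⟨τ, hτ, h0, hs⟩ : ∃ τ, 0 < τ ∧ -A * τ ^ 2 + C * τ - 2 * C = 0 ∧
        (0 < C + τ * A ∨ C + τ * A < 0) := by
      have e1 : -A * (-C / A) ^ 2 + C * (-C / A) - 2 * C = -2 * C / A * (A + C) := by
        field_simp; ring
      have hCA : 0 < -C / A := div_pos_of_neg_of_neg (by linarith) hA
      rcases h with ⟨h, -⟩ | ⟨h, -⟩
      · obtain ⟨τ, h1, h2, h3⟩ := exists_root_Ioo (f := fun τ => -A * τ ^ 2 + C * τ - 2 * C)
          (by fun_prop) (a := 0) (b := -C / A) hCA (by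
            rw [e1]
            have : 0 < -2 * C / A * (A + C) :=
              mul_pos (div_pos_of_neg_of_neg (by linarith) hA) h
            nlinarith)
        rw [lt_div_iff_of_neg hA] at h2
        exact ⟨τ, h1, h3, Or.inl (by linarith)⟩
      · obtain ⟨τ, h1, h2, h3⟩ := exists_root_Ioo (f := fun τ => -A * τ ^ 2 + C * τ - 2 * C)
          (by fun_prop) (a := -C / A) (b := 1) (by rw [div_lt_iff_of_neg hA]; linarith) (by
            rw [e1]
            refine mul_neg_of_neg_of_pos
              (mul_neg_of_pos_of_neg (div_pos_of_neg_of_neg (by linarith) hA) h) (by linarith))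
        have h4 := h1
        rw [div_lt_iff_of_neg hA] at h1
        exact ⟨τ, hCA.trans h4, h3, Or.inr (by linarith)⟩
    refine exists_of_neg_neg_pos_of_root hA hA hC hτ ?_ ?_
    · linear_combination (-(A * τ) - C) * h0
    · exact hs.imp (fun h => ⟨h, h⟩) fun h => ⟨h, h⟩
  · rcases h with ⟨ha, hb⟩ | ⟨ha, hb⟩
    -- As `A < B < 0`, `-C / A` is the smaller of `-C / A` and `-C / B`; to its left both `C + τ A`
    -- and `C + τ B` are positive.
    · obtain ⟨τ, h1, h2, h3⟩ := exists_root_Ioo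
        (f := fun τ => A * B * τ ^ 3 + C * (A + B - C) * τ + 2 * C ^ 2) (by fun_prop)
        (a := 0) (b := -C / A) (div_pos_of_neg_of_neg (by linarith) hA) (by
          have e1 : A * B * (-C / A) ^ 3 + C * (A + B - C) * (-C / A) + 2 * C ^ 2 =
            C ^ 2 / A ^ 2 * ((A + C) * (A - B)) := by field_simp; ring
          rw [e1]
          have e2 : 0 < A * B * 0 ^ 3 + C * (A + B - C) * 0 + 2 * C ^ 2 := by
            have : 0 < 2 * C ^ 2 := by positivity
            linarith
          exact mul_neg_of_pos_of_neg e2 (mul_neg_of_pos_of_neg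
            (div_pos (by positivity) (sq_pos_of_neg hA))
            (mul_neg_of_pos_of_neg ha (by linarith))))
      rw [lt_div_iff_of_neg hA] at h2
      refine exists_of_neg_neg_pos_of_root hA hB hC h1 h3 (Or.inl ⟨by linarith, ?_⟩)
      nlinarith
    · obtain ⟨τ, h1, h2, h3⟩ := exists_root_Ioo
        (f := fun τ => A * B * τ ^ 3 + C * (A + B - C) * τ + 2 * C ^ 2) (by fun_prop)
        (a := -C / B) (b := 1) (by rw [div_lt_iff_of_neg hB]; linarith) (by
          have e1 : A * B * (-C / B) ^ 3 + C * (A + B - C) * (-C / B) + 2 * C ^ 2 =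
            C ^ 2 / B ^ 2 * ((B + C) * (B - A)) := by field_simp; ring
          have e2 : A * B * 1 ^ 3 + C * (A + B - C) * 1 + 2 * C ^ 2 = (A + C) * (B + C) := by ring
          rw [e1, e2]
          exact mul_neg_of_neg_of_pos (mul_neg_of_pos_of_neg
            (div_pos (by positivity) (sq_pos_of_neg hB))
            (mul_neg_of_neg_of_pos hb (by linarith))) (mul_pos_of_neg_of_neg ha hb))
      have hτ : 0 < τ := (div_pos_of_neg_of_neg (by linarith) hB).trans h1
      rw [div_lt_iff_of_neg hB] at h1
      refine exists_of_neg_neg_pos_of_root hA hB hC hτ h3 (Or.inr ⟨?_, by linarith⟩)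
      nlinarith

theorem exists_of_neg_neg_pos (hA : A < 0) (hB : B < 0) (hC : 0 < C)
    (h : (0 < A + C ∧ 0 < B + C) ∨ (A + C < 0 ∧ B + C < 0)) :
    ∃ k x y z, DiagEq A B C k x y z := by
  rcases le_total A B with hAB | hAB
  · exact exists_of_neg_neg_pos_of_le hA hB hC hAB h
  · obtain ⟨k, x, y, z, h⟩ := exists_of_neg_neg_pos_of_le hB hA hC hAB
      (h.imp And.symm And.symm)
    exact ⟨k, y, x, z, h.swap⟩

theorem exists_of_uniqueCase {t : Fin 3 → ℝ} (ht : UniqueCase t) :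
    ∃ k x y z, DiagEq (t 0) (t 1) (t 2) k x y z := by
  rcases ht with ⟨h0, h1, h2, h⟩ | ⟨h1, h0, h2, h⟩ | ⟨h0, h1, h2, h⟩ | ⟨h0, h1, h2, h⟩
  · exact exists_of_pos_neg_neg h0 h1 h2 (by linarith)
  · obtain ⟨k, x, y, z, h⟩ := exists_of_pos_neg_neg h1 h0 h2 (by linarith)
    exact ⟨k, y, x, z, h.swap⟩
  · rw [max_lt_iff] at h
    exact exists_of_neg_neg_pos h0 h1 h2 (Or.inl ⟨by linarith, by linarith⟩)
  · rw [lt_min_iff] at h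
    exact exists_of_neg_neg_pos h0 h1 h2 (Or.inr ⟨by linarith, by linarith⟩)

theorem eq_of_uniqueCase {t : Fin 3 → ℝ} (ht : UniqueCase t)
    (h : DiagEq (t 0) (t 1) (t 2) k x y z) (h' : DiagEq (t 0) (t 1) (t 2) k' x' y' z') :
    k' = k ∧ ∃ s, 0 < s ∧ x' = s * x ∧ y' = s * y ∧ z' = s * z := by
  obtain ⟨s, x, y, z, hs, hn, hs1, rfl, rfl, rfl⟩ := h.normalize
  obtain ⟨s', x', y', z', hs', hn', hs1', rfl, rfl, rfl⟩ := h'.normalize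
  have key : k' = k ∧ x' = x ∧ y' = y ∧ z' = z := by
    have hz : (t 0 ≠ 0 ∧ t 2 ≠ 0 ∧ t 0 + t 2 ≠ 0) ∧ z' = z := by
      rcases ht with ⟨h0, h1, h2, h3⟩ | ⟨h1, h0, h2, h3⟩ | ⟨h0, h1, h2, h3⟩ | ⟨h0, h1, h2, h3⟩
      · exact ⟨⟨h0.ne', h2.ne, by linarith⟩,
          hn.z_eq_of_mul_neg hs1 hn' hs1' (mul_neg_of_pos_of_neg h0 h1) h2.ne⟩
      · exact ⟨⟨h0.ne, h2.ne, by linarith⟩,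
          hn.z_eq_of_mul_neg hs1 hn' hs1' (mul_neg_of_neg_of_pos h0 h1) h2.ne⟩
      · rw [max_lt_iff] at h3
        exact ⟨⟨h0.ne, h2.ne', by linarith⟩, hn.z_eq_of_neg hs1 hn' hs1' h0 h1 h2
          (mul_pos (by linarith) (by linarith))⟩
      · rw [lt_min_iff] at h3
        exact ⟨⟨h0.ne, h2.ne', by linarith⟩, hn.z_eq_of_neg hs1 hn' hs1' h0 h1 h2
          (mul_pos_of_neg_of_neg (by linarith) (by linarith))⟩
    obtain ⟨⟨hA, hC, hAC⟩, hz⟩ := hz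
    obtain ⟨e1, e2, e3⟩ := hn.eq_of_z_eq hs1 hn' hs1' hA hC hAC hz
    exact ⟨e1, e2, e3, hz⟩
  obtain ⟨rfl, rfl, rfl, rfl⟩ := key
  refine ⟨rfl, s' / s, by positivity, ?_, ?_, ?_⟩ <;> field_simp

/-- The cases correspond to the signs of `P` and `Q` and, when both are negative, of `x + y - z`.
The family cases are exactly the vanishing of one of these. -/
theorem uniqueCase_or_familyCase {t : Fin 3 → ℝ} (h : DiagEq (t 0) (t 1) (t 2) k x y z) :
    UniqueCase t ∨ FamilyCase t := by
  have hx := h.x_pos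
  have hy := h.y_pos
  have hz := h.z_pos
  have hk := h.k_pos
  have hC := h.C_mul_eq
  have h1 := h.eq_A_add_C
  have h2 := h.swap.eq_A_add_C
  have hkxy : 0 < k * (x * y) := by positivity
  have hkxyz : 0 < k * (x * y * z) := by positivity
  have hkyxz : 0 < k * (y * x * z) := by positivity
  have pos_case : ∀ {A B C x y z : ℝ}, DiagEq A B C k x y z → y + z < x →
      0 < A ∧ B < 0 ∧ C < 0 ∧ -A < C := by
    intro A B C x y z h hP
    have hx := h.x_pos
    have hy := h.y_pos
    have hz := h.z_pos
    have hk := h.k_pos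
    have e1 := h.C_mul_eq
    have e2 := h.eq_A_add_C
    refine ⟨h.A_pos_iff.2 hP, h.swap.A_neg_iff.2 (by linarith), ?_, ?_⟩
    · have : 0 < k * (x * y) * (-C) := by
        have : 0 < 2 * ((x - y - z) * (x + z - y)) :=
          mul_pos two_pos (mul_pos (by linarith) (by linarith))
        linarith
      linarith [(mul_pos_iff_of_pos_left (by positivity)).1 this]
    · have : 0 < k * (x * y * z) * (A + C) := by
        rw [e2]
        exact mul_pos (by linarith) (mul_pos (by linarith) (by linarith))
      linarith [(mul_pos_iff_of_pos_left (by positivity)).1 this]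
  rcases lt_trichotomy x (y + z) with hP | hP | hP
  · rcases lt_trichotomy y (x + z) with hQ | hQ | hQ
    · have hA := h.A_neg_iff.2 hP
      have hB := h.swap.A_neg_iff.2 hQ
      have hC' : 0 < t 2 := by
        refine (mul_pos_iff_of_pos_left hkxy).1 ?_
        rw [hC]
        exact mul_pos two_pos (mul_pos_of_neg_of_neg (by linarith) (by linarith))
      rcases lt_trichotomy (x + y) z with hR | hR | hR
      · refine Or.inl (Or.inr (Or.inr (Or.inl ⟨hA, hB, hC', max_lt ?_ ?_⟩)))
        · have : 0 < t 0 + t 2 := by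
            refine (mul_pos_iff_of_pos_left hkxyz).1 ?_
            rw [h1]
            exact mul_pos_of_neg_of_neg (by linarith)
              (mul_neg_of_pos_of_neg (by linarith) (by linarith))
          linarith
        · have : 0 < t 1 + t 2 := by
            refine (mul_pos_iff_of_pos_left hkyxz).1 ?_
            rw [h2]
            exact mul_pos_of_neg_of_neg (by linarith)
              (mul_neg_of_pos_of_neg (by linarith) (by linarith))
          linarith
      · refine Or.inr (Or.inl ?_)
        have e1 : t 0 + t 2 = 0 := by
          refine (mul_eq_zero.1 (h1.trans ?_)).resolve_left hkxyz.ne'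
          rw [hR]; ring
        have e2 : t 1 + t 2 = 0 := by
          refine (mul_eq_zero.1 (h2.trans ?_)).resolve_left hkyxz.ne'
          rw [← hR]; ring
        exact ⟨by linarith, by linarith, by linarith⟩
      · refine Or.inl (Or.inr (Or.inr (Or.inr ⟨hA, hB, hC', lt_min ?_ ?_⟩)))
        · have : 0 < -(t 0 + t 2) := by
            refine (mul_pos_iff_of_pos_left hkxyz).1 ?_
            rw [mul_neg, h1, neg_pos]
            exact mul_neg_of_neg_of_pos (by linarith) (mul_pos (by linarith) (by linarith))
          linarith
        · have : 0 < -(t 1 + t 2) := by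
            refine (mul_pos_iff_of_pos_left hkyxz).1 ?_
            rw [mul_neg, h2, neg_pos]
            exact mul_neg_of_neg_of_pos (by linarith) (mul_pos (by linarith) (by linarith))
          linarith
    · refine Or.inr (Or.inr (Or.inl ⟨h.A_neg_iff.2 hP, h.swap.A_eq_zero_iff.2 hQ, ?_⟩))
      refine (mul_eq_zero.1 (hC.trans ?_)).resolve_left hkxy.ne'
      rw [hQ]; ring
    · obtain ⟨a, b, c, d⟩ := pos_case h.swap hQ
      exact Or.inl (Or.inr (Or.inl ⟨a, b, c, d⟩))
  · refine Or.inr (Or.inr (Or.inr ⟨h.swap.A_neg_iff.2 (by linarith), h.A_eq_zero_iff.2 hP, ?_⟩))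
    refine (mul_eq_zero.1 (hC.trans ?_)).resolve_left hkxy.ne'
    rw [hP]; ring
  · exact Or.inl (Or.inl (pos_case h hP))

/-- On the plane `z = x + y` each right-hand side is `±8` times the product on its left, for
instance `x² - (y + z)² = -4yz`, so `x` and `y` stay free. -/
theorem of_eq_neg {A x y : ℝ} (hA : A < 0) (hx : 0 < x) (hy : 0 < y) :
    DiagEq A A (-A) (-8 / A) x y (x + y) where
  x_pos := hx
  y_pos := hy
  z_pos := by positivity
  k_pos := div_pos_of_neg_of_neg (by norm_num) hA
  eq_A := by rw [div_mul_cancel₀ _ hA.ne]; ring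
  eq_B := by rw [div_mul_cancel₀ _ hA.ne]; ring
  eq_C := by rw [mul_neg, div_mul_cancel₀ _ hA.ne]; ring

theorem of_neg_zero_zero {A x z : ℝ} (hA : A < 0) (hx : 0 < x) (hz : 0 < z) :
    DiagEq A 0 0 (-8 / A) x (x + z) z where
  x_pos := hx
  y_pos := by positivity
  z_pos := hz
  k_pos := div_pos_of_neg_of_neg (by norm_num) hA
  eq_A := by rw [div_mul_cancel₀ _ hA.ne]; ring
  eq_B := by ring
  eq_C := by ring

end DiagEq
end SL2R

/-! ### Simultaneous diagonalization and Milnor bases -/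

/-- Simultaneous diagonalization of a scalar product and a symmetric bilinear form. -/
theorem exists_basis_diagonal {M : Type*} [AddCommGroup M] [Module ℝ M] [FiniteDimensional ℝ M]
    {n : ℕ} (hn : Module.finrank ℝ M = n) (g K : LinearMap.BilinForm ℝ M)
    (hg : ∀ u v, g u v = g v u) (hpos : ∀ u, u ≠ 0 → 0 < g u u) (hK : ∀ u v, K u v = K v u) :
    ∃ (b : Module.Basis (Fin n) ℝ M) (μ : Fin n → ℝ), (∀ i j, g (b i) (b j) = if i = j then 1 else 0) ∧
      ∀ i j, K (b i) (b j) = if i = j then μ i else 0 := by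
  let core : InnerProductSpace.Core ℝ M :=
    { inner := fun u v => g u v
      conj_inner_symm := fun u v => hg v u
      re_inner_nonneg := fun u => by
        rcases eq_or_ne u 0 with rfl | hu
        · simp
        · exact (hpos u hu).le
      add_left := fun u v w => by simp
      smul_left := fun u v r => by simp
      definite := fun u hu => by
        by_contra h
        exact (hpos u h).ne' hu }
  let _ : NormedAddCommGroup M := core.toNormedAddCommGroup
  let _ : InnerProductSpace ℝ M := InnerProductSpace.ofCore core.toCore
  have hin : ∀ u v : M, inner ℝ u v = g u v := fun u v => rfl
  -- The operator representing `K` with respect to `g`; its orthonormal eigenbasis diagonalizes both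
  -- forms.
  let A : M →ₗ[ℝ] M := (InnerProductSpace.toDual ℝ M).symm.toLinearEquiv.toLinearMap ∘ₗ
    LinearMap.toContinuousLinearMap.toLinearMap ∘ₗ K
  have hA : ∀ u v, inner ℝ (A u) v = K u v := fun u v => by simp [A]
  have hsymm : A.IsSymmetric := fun u v => by
    rw [hA, real_inner_comm, hA, hK]
  refine ⟨(hsymm.eigenvectorBasis hn).toBasis, hsymm.eigenvalues hn, fun i j => ?_, fun i j => ?_⟩
  · rw [← hin, OrthonormalBasis.coe_toBasis]
    exact orthonormal_iff_ite.1 (hsymm.eigenvectorBasis hn).orthonormal i j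
  · rw [← hA, OrthonormalBasis.coe_toBasis, hsymm.apply_eigenvectorBasis, inner_smul_left,
      orthonormal_iff_ite.1 (hsymm.eigenvectorBasis hn).orthonormal i j]
    simp

namespace SL2R

theorem killingForm_of_isMilnorBasis {lam : Fin 3 → ℝ} {V : Module.Basis (Fin 3) ℝ LieAlg}
    (hV : IsMilnorBasis lam V) (i j : Fin 3) :
    killingForm ℝ LieAlg (V i) (V j) =
      if i = j then -2 * lam (i + 1) * lam (i + 2) else 0 := by
  rw [killingForm_apply_apply, LinearMap.trace_eq_matrix_trace ℝ V]
  simp only [Matrix.trace, Matrix.diag, LinearMap.toMatrix_apply, Fin.sum_univ_three,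
    LinearMap.comp_apply, LieAlgebra.ad_apply, hV _ _, map_add, map_smul,
    Finsupp.add_apply, Finsupp.smul_apply, Module.Basis.repr_self]
  fin_cases i <;> fin_cases j <;> simp [eps] <;> ring

theorem killingForm_comm (u v : LieAlg) : killingForm ℝ LieAlg u v = killingForm ℝ LieAlg v u :=
  LieModule.traceForm_comm ℝ LieAlg LieAlg u v

theorem killingForm_lie (u v w : LieAlg) :
    killingForm ℝ LieAlg ⁅u, v⁆ w = killingForm ℝ LieAlg u ⁅v, w⁆ :=
  LieModule.traceForm_apply_lie_apply ℝ LieAlg LieAlg u v w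

/-- The multiples `-H`, `-X`, `-W` of the standard basis of `sl(2)`. -/
theorem exists_isMilnorBasis :
    ∃ V : Module.Basis (Fin 3) ℝ LieAlg, IsMilnorBasis ![2, 2, -2] V := by
  let v : Fin 3 → LieAlg := ![((-1, 0, 0) : ℝ × ℝ × ℝ), ((0, -1, -1) : ℝ × ℝ × ℝ),
    ((0, -1, 1) : ℝ × ℝ × ℝ)]
  have hli : LinearIndependent ℝ v := by
    rw [Fintype.linearIndependent_iff]
    intro a ha
    have h1 : (a 0 • ((-1, 0, 0) : ℝ × ℝ × ℝ) + a 1 • ((0, -1, -1) : ℝ × ℝ × ℝ) +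
      a 2 • ((0, -1, 1) : ℝ × ℝ × ℝ)) = 0 := by
      rw [Fin.sum_univ_three] at ha
      exact ha
    simp only [Prod.smul_mk, Prod.mk_add_mk, Prod.mk_eq_zero, smul_eq_mul] at h1
    obtain ⟨e0, e1, e2⟩ := h1
    intro i
    fin_cases i <;> simp <;> linarith
  have hcard : Fintype.card (Fin 3) = Module.finrank ℝ LieAlg := by
    have : Module.finrank ℝ (ℝ × ℝ × ℝ) = 3 := by simp
    exact this.symm
  refine ⟨basisOfLinearIndependentOfCardEqFinrank hli hcard, fun i j => ?_⟩
  simp only [coe_basisOfLinearIndependentOfCardEqFinrank]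
  refine (bracket_eq _ _).trans ?_
  rw [Fin.sum_univ_three]
  change _ = (eps i j 0 * 2) • ((-1, 0, 0) : ℝ × ℝ × ℝ) +
    (eps i j 1 * 2) • ((0, -1, -1) : ℝ × ℝ × ℝ) + (eps i j 2 * -2) • ((0, -1, 1) : ℝ × ℝ × ℝ)
  fin_cases i <;> fin_cases j <;> simp [v, eps] <;> norm_num

/-- A basis that is orthogonal for the Killing form satisfies Milnor type bracket relations. -/
theorem isMilnorBasis_of_killingForm {V : Module.Basis (Fin 3) ℝ LieAlg} {μ : Fin 3 → ℝ}
    (hμ : ∀ i, μ i ≠ 0)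
    (hV : ∀ i j, killingForm ℝ LieAlg (V i) (V j) = if i = j then μ i else 0) :
    IsMilnorBasis (fun k => killingForm ℝ LieAlg ⁅V 0, V 1⁆ (V 2) / μ k) V := by
  have hcoord : ∀ (u : LieAlg) k, V.repr u k = killingForm ℝ LieAlg u (V k) / μ k := by
    intro u k
    have h := congrArg (fun w => killingForm ℝ LieAlg w (V k)) (V.sum_repr u)
    simp only [map_sum, LinearMap.sum_apply, map_smul, LinearMap.smul_apply, hV, smul_eq_mul,
      mul_ite, mul_zero, Finset.sum_ite_eq', Finset.mem_univ, if_true] at h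
    rw [← h, mul_div_cancel_right₀ _ (hμ k)]
  -- Invariance and symmetry make `K([u,v],w)` alternating, so on basis triples it is `eps` times
  -- its value at `(V 0, V 1, V 2)`.
  have f1 : ∀ i k, killingForm ℝ LieAlg ⁅V i, V i⁆ (V k) = 0 := fun i k => by simp
  have f2 : ∀ i j k, killingForm ℝ LieAlg ⁅V i, V j⁆ (V k) =
      killingForm ℝ LieAlg ⁅V j, V k⁆ (V i) := fun i j k => by
    rw [killingForm_lie, killingForm_comm]
  have f3 : ∀ i j k, killingForm ℝ LieAlg ⁅V i, V j⁆ (V k) =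
      -killingForm ℝ LieAlg ⁅V j, V i⁆ (V k) := fun i j k => by
    rw [← lie_skew (V i) (V j), map_neg, LinearMap.neg_apply]
  have f4 : ∀ i j, killingForm ℝ LieAlg ⁅V i, V j⁆ (V i) = 0 := fun i j => by
    rw [f2, f2, f1]
  have f5 : ∀ i j, killingForm ℝ LieAlg ⁅V i, V j⁆ (V j) = 0 := fun i j => by
    rw [f2, f1]
  intro i j
  rw [← V.sum_repr ⁅V i, V j⁆]
  refine Finset.sum_congr rfl fun k _ => ?_
  rw [hcoord]
  congr 1
  rw [mul_div_assoc']
  congr 1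
  have e1 := f2 0 1 2
  have e2 := f2 1 2 0
  have e3 := f3 1 0 2
  have e4 := f3 2 1 0
  have e5 := f3 0 2 1
  fin_cases i <;> fin_cases j <;> fin_cases k <;> simp [eps, f4, f5] <;> linarith

/-- Computing the Killing form from the structure constants `r / μ k` gives `μ 0 μ 1 μ 2 = -2 r² <
0`. It takes the value 8 on a Milnor vector, so not all `μ i` are negative; exactly one is, and it
is moved to the last place. -/
theorem exists_killingForm_signature (B : LinearMap.BilinForm ℝ LieAlg)
    (hB : ∀ u v, B u v = B v u) (hpos : ∀ u, u ≠ 0 → 0 < B u u) :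
    ∃ (b : Module.Basis (Fin 3) ℝ LieAlg) (μ : Fin 3 → ℝ), 0 < μ 0 ∧ 0 < μ 1 ∧ μ 2 < 0 ∧
      (∀ i j, B (b i) (b j) = if i = j then 1 else 0) ∧
      ∀ i j, killingForm ℝ LieAlg (b i) (b j) = if i = j then μ i else 0 := by
  obtain ⟨V, hV⟩ := exists_isMilnorBasis
  have hfin : FiniteDimensional ℝ LieAlg := Module.Basis.finiteDimensional_of_finite V
  have hrank : Module.finrank ℝ LieAlg = 3 := by
    rw [Module.finrank_eq_card_basis V, Fintype.card_fin]
  obtain ⟨b, μ, hb, hμ⟩ := exists_basis_diagonal hrank B (killingForm ℝ LieAlg) hB hpos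
    killingForm_comm
  have hK := killingForm_of_isMilnorBasis hV
  have hμ0 : ∀ i, μ i ≠ 0 := by
    intro i hi
    have h1 : ∀ u, killingForm ℝ LieAlg (b i) u = 0 := by
      intro u
      rw [← b.sum_repr u]
      simp only [map_sum, map_smul, hμ, hi]
      simp
    refine b.ne_zero i (V.ext_elem fun k => ?_)
    have h2 := h1 (V k)
    rw [← V.sum_repr (b i)] at h2
    simp only [map_sum, LinearMap.sum_apply, map_smul, LinearMap.smul_apply, hK, smul_eq_mul,
      mul_ite, mul_zero, Finset.sum_ite_eq', Finset.mem_univ, if_true] at h2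
    rw [map_zero, Finsupp.zero_apply]
    refine (mul_eq_zero.1 h2).resolve_right ?_
    fin_cases k <;> simp
  have hbm := isMilnorBasis_of_killingForm hμ0 hμ
  have hKb := killingForm_of_isMilnorBasis hbm
  set r := killingForm ℝ LieAlg ⁅b 0, b 1⁆ (b 2)
  have hprod : μ 0 * μ 1 * μ 2 < 0 := by
    have h1 := hKb 0 0
    rw [hμ, if_pos rfl, if_pos rfl] at h1
    have h2 : μ 0 = -2 * (r / μ 1) * (r / μ 2) := h1
    have h1' := hμ0 1
    have h2' := hμ0 2
    have h3 : μ 0 * μ 1 * μ 2 = -2 * r ^ 2 := by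
      rw [h2]; field_simp
    have h4 : r ≠ 0 := fun h => hμ0 0 (by rw [h2, h]; simp)
    have : 0 < r ^ 2 := by positivity
    linarith
  have hexpos : ∃ i, 0 < μ i := by
    by_contra! hcon
    have h1 : killingForm ℝ LieAlg (V 0) (V 0) = 8 := by
      rw [hK, if_pos rfl]
      show (-2 : ℝ) * 2 * -2 = 8
      norm_num
    rw [← b.sum_repr (V 0)] at h1
    simp only [map_sum, LinearMap.sum_apply, map_smul, LinearMap.smul_apply, hμ, smul_eq_mul,
      mul_ite, mul_zero, Finset.sum_ite_eq', Finset.mem_univ, if_true] at h1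
    rw [Fin.sum_univ_three] at h1
    nlinarith [mul_nonneg (sq_nonneg (b.repr (V 0) 0)) (neg_nonneg.2 (hcon 0)),
      mul_nonneg (sq_nonneg (b.repr (V 0) 1)) (neg_nonneg.2 (hcon 1)),
      mul_nonneg (sq_nonneg (b.repr (V 0) 2)) (neg_nonneg.2 (hcon 2))]
  have hre : ∀ σ : Equiv.Perm (Fin 3), (∀ i j, B (b.reindex σ i) (b.reindex σ j) =
      if i = j then 1 else 0) ∧ ∀ i j, killingForm ℝ LieAlg (b.reindex σ i) (b.reindex σ j) =
      if i = j then μ (σ.symm i) else 0 := fun σ => by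
    simp [hb, hμ]
  rcases lt_or_gt_of_ne (hμ0 2) with h2 | h2
  · have h01 : 0 < μ 0 * μ 1 := by
      by_contra hcon
      nlinarith
    rcases mul_pos_iff.1 h01 with ⟨h0, h1⟩ | ⟨h0, h1⟩
    · exact ⟨b, μ, h0, h1, h2, hb, hμ⟩
    · obtain ⟨i, hi⟩ := hexpos
      fin_cases i
      · exact absurd hi h0.not_gt
      · exact absurd hi h1.not_gt
      · exact absurd hi h2.not_gt
  · have h01 : μ 0 * μ 1 < 0 := by
      by_contra hcon
      nlinarith
    rcases mul_neg_iff.1 h01 with ⟨h0, h1⟩ | ⟨h0, h1⟩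
    · exact ⟨b.reindex (Equiv.swap 1 2), fun i => μ ((Equiv.swap 1 2).symm i), h0, h2, h1, hre _⟩
    · exact ⟨b.reindex (Equiv.swap 0 2), fun i => μ ((Equiv.swap 0 2).symm i), h2, h1, h0, hre _⟩

/-- Every scalar product on the Lie algebra is diagonal in some Milnor basis. -/
theorem exists_isMilnorBasis_diagonal (B : LinearMap.BilinForm ℝ LieAlg)
    (hB : ∀ u v, B u v = B v u) (hpos : ∀ u, u ≠ 0 → 0 < B u u) :
    ∃ (V : Module.Basis (Fin 3) ℝ LieAlg) (x : Fin 3 → ℝ), IsMilnorBasis ![2, 2, -2] V ∧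
      (∀ i, 0 < x i) ∧ ∀ i j, B (V i) (V j) = if i = j then x i else 0 := by
  obtain ⟨b, μ, h0, h1, h2, hb, hμ⟩ := exists_killingForm_signature B hB hpos
  let s : Fin 3 → ℝ := ![√(8 / μ 0), √(8 / μ 1), √(8 / -μ 2)]
  have hs : ∀ i, 0 < s i := by
    intro i
    fin_cases i
    · exact Real.sqrt_pos.2 (by positivity)
    · exact Real.sqrt_pos.2 (by positivity)
    · exact Real.sqrt_pos.2 (div_pos (by norm_num) (by linarith))
  have hsμ : ∀ i, s i * s i * μ i = ![8, 8, -8] i := by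
    intro i
    fin_cases i
    · show √(8 / μ 0) * √(8 / μ 0) * μ 0 = 8
      rw [Real.mul_self_sqrt (by positivity), div_mul_cancel₀ _ h0.ne']
    · show √(8 / μ 1) * √(8 / μ 1) * μ 1 = 8
      rw [Real.mul_self_sqrt (by positivity), div_mul_cancel₀ _ h1.ne']
    · show √(8 / -μ 2) * √(8 / -μ 2) * μ 2 = -8
      rw [Real.mul_self_sqrt (div_pos (by norm_num) (by linarith)).le, div_neg, neg_mul,
        div_mul_cancel₀ _ h2.ne]
  let U := b.isUnitSMul fun i => (hs i).ne'.isUnit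
  have hU : ∀ i, U i = s i • b i := fun i => Module.Basis.isUnitSMul_apply _ _
  have hBU : ∀ i j, B (U i) (U j) = if i = j then s i ^ 2 else 0 := by
    intro i j
    rw [hU, hU, map_smul, map_smul, LinearMap.smul_apply, hb]
    split_ifs with h
    · subst h; simp [sq]
    · simp
  have hKU : ∀ i j, killingForm ℝ LieAlg (U i) (U j) = if i = j then ![8, 8, -8] i else 0 := by
    intro i j
    rw [hU, hU, map_smul, map_smul, LinearMap.smul_apply, hμ, ← hsμ i]
    split_ifs with h
    · subst h; simp only [smul_eq_mul]; ring
    · simp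
  have hUM := isMilnorBasis_of_killingForm (by intro i; fin_cases i <;> simp) hKU
  set r := killingForm ℝ LieAlg ⁅U 0, U 1⁆ (U 2)
  -- After rescaling, the structure constants are `r / 8`, `r / 8`, `-r / 8`, and the Killing form
  -- computed from them must again be 8 on `U 0`.
  have hr : (r - 16) * (r + 16) = 0 := by
    have e1 := killingForm_of_isMilnorBasis hUM 0 0
    rw [hKU, if_pos rfl, if_pos rfl] at e1
    have e2 : (8 : ℝ) = -2 * (r / 8) * (r / -8) := e1
    linear_combination -32 * e2
  rcases mul_eq_zero.1 hr with h | h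
  · refine ⟨U, _, ?_, fun i => sq_pos_of_pos (hs i), hBU⟩
    convert hUM using 1
    funext k
    rw [show r = 16 by linarith]
    fin_cases k <;> norm_num
  -- Negating the basis reverses the signs of the structure constants without changing the values of
  -- bilinear forms.
  · refine ⟨U.map (LinearEquiv.neg ℝ), fun i => s i ^ 2, fun i j => ?_,
      fun i => sq_pos_of_pos (hs i), fun i j => ?_⟩
    · simp only [Module.Basis.map_apply, LinearEquiv.neg_apply, neg_lie, lie_neg, neg_neg, hUM i j]
      refine Finset.sum_congr rfl fun k _ => ?_
      rw [show r = -16 by linarith, smul_neg, ← neg_smul]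
      congr 1
      fin_cases k <;> norm_num
    · simp only [Module.Basis.map_apply, LinearEquiv.neg_apply, map_neg, LinearMap.neg_apply,
        neg_neg, hBU]

end SL2R

/-! ### Comparison of two Milnor bases -/

namespace SL2R

/-- The signs of the Killing form in a Milnor basis. -/
def milnorSign : Fin 3 → ℝ := ![1, 1, -1]

theorem milnorSign_mul_self (i : Fin 3) : milnorSign i * milnorSign i = 1 := by
  fin_cases i <;> norm_num [milnorSign]

theorem killingForm_milnor {V : Module.Basis (Fin 3) ℝ LieAlg}
    (hV : IsMilnorBasis ![2, 2, -2] V) (i j : Fin 3) :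
    killingForm ℝ LieAlg (V i) (V j) = if i = j then 8 * milnorSign i else 0 := by
  rw [killingForm_of_isMilnorBasis hV]
  congr 1
  fin_cases i
  · show (-2 : ℝ) * 2 * -2 = 8 * 1; norm_num
  · show (-2 : ℝ) * -2 * 2 = 8 * 1; norm_num
  · show (-2 : ℝ) * 2 * 2 = 8 * -1; norm_num

theorem repr_eq_killingForm {V : Module.Basis (Fin 3) ℝ LieAlg}
    (hV : IsMilnorBasis ![2, 2, -2] V) (u : LieAlg) :
    u = ∑ i, (milnorSign i * killingForm ℝ LieAlg (V i) u / 8) • V i := by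
  have h : ∀ i, V.repr u i = milnorSign i * killingForm ℝ LieAlg (V i) u / 8 := by
    intro i
    have h := congrArg (fun w => killingForm ℝ LieAlg (V i) w) (V.sum_repr u)
    simp only [map_sum, map_smul, killingForm_milnor hV, smul_eq_mul,
      mul_ite, mul_zero, Finset.sum_ite_eq, Finset.mem_univ, if_true] at h
    rw [← h]
    linear_combination -(V.repr u i) * milnorSign_mul_self i
  conv_lhs => rw [← V.sum_repr u]
  simp only [h]

theorem bilin_sum {ι : Type*} (s : Finset ι) (B : LieAlg →L[ℝ] LieAlg →L[ℝ] ℝ) (a : ι → ℝ)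
    (v : ι → LieAlg) (w : LieAlg) : B (∑ i ∈ s, a i • v i) w = ∑ i ∈ s, a i * B (v i) w := by
  rw [map_sum]
  simp

/-- Expanding `V i` in `W` shows that the matrix `K(V i, W j) / 8` is pseudo-orthogonal of signature
(2, 1). -/
theorem sum_killingForm_left {V W : Module.Basis (Fin 3) ℝ LieAlg}
    (hV : IsMilnorBasis ![2, 2, -2] V) (hW : IsMilnorBasis ![2, 2, -2] W) (i k : Fin 3) :
    ∑ j, milnorSign j * (killingForm ℝ LieAlg (V i) (W j) * killingForm ℝ LieAlg (V k) (W j)) =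
      if i = k then 64 * milnorSign i else 0 := by
  have h := killingForm_milnor hV i k
  rw [repr_eq_killingForm hW (V i)] at h
  simp only [map_sum, LinearMap.sum_apply, map_smul, LinearMap.smul_apply, smul_eq_mul] at h
  have h2 : (8 : ℝ) * (if i = k then 8 * milnorSign i else 0) =
      if i = k then 64 * milnorSign i else 0 := by split_ifs <;> ring
  rw [← h2, ← h, Finset.mul_sum]
  refine Finset.sum_congr rfl fun j _ => ?_
  rw [killingForm_comm (W j) (V i), killingForm_comm (W j) (V k)]
  ring

/-- Write `T = K(L ·, ·) / 8`. Then `V i` and `W j` are eigenvectors of the self-adjoint `L` with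
eigenvalues `milnorSign i * t i` and `milnorSign j * t' j`, and eigenvectors for different
eigenvalues are `K`-orthogonal. -/
theorem eigenvalue_relation {V W : Module.Basis (Fin 3) ℝ LieAlg}
    (hV : IsMilnorBasis ![2, 2, -2] V) (hW : IsMilnorBasis ![2, 2, -2] W)
    {T : TensorField02 𝓘(ℝ, ℝ × ℝ × ℝ) SL2R} {t t' : Fin 3 → ℝ}
    (hTV : IsDiagIn T V t) (hTW : IsDiagIn T W t') (i j : Fin 3) :
    (milnorSign i * t i - milnorSign j * t' j) * killingForm ℝ LieAlg (V i) (W j) = 0 := by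
  have h1 : T 1 (V i) (W j) = milnorSign i * killingForm ℝ LieAlg (V i) (W j) / 8 * t i := by
    conv_lhs => rw [repr_eq_killingForm hV (W j)]
    have hTV' : ∀ i j, T 1 (V i) (V j) = if i = j then t i else 0 := hTV
    rw [map_sum]
    simp [hTV']
  have h2 : T 1 (V i) (W j) = milnorSign j * killingForm ℝ LieAlg (V i) (W j) / 8 * t' j := by
    conv_lhs => rw [repr_eq_killingForm hW (V i)]
    have hTW' : ∀ i j, T 1 (W i) (W j) = if i = j then t' i else 0 := hTW
    rw [bilin_sum]
    simp [hTW', killingForm_comm (W j)]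
  linear_combination 8 * (h2 - h1)

theorem tensor_eq_sum {W : Module.Basis (Fin 3) ℝ LieAlg}
    (hW : IsMilnorBasis ![2, 2, -2] W) {g : TensorField02 𝓘(ℝ, ℝ × ℝ × ℝ) SL2R} {x : Fin 3 → ℝ}
    (hg : IsDiagIn g W x) (u v : LieAlg) :
    g 1 u v = ∑ j, killingForm ℝ LieAlg u (W j) * killingForm ℝ LieAlg v (W j) * x j / 64 := by
  have hg' : ∀ i j, g 1 (W i) (W j) = if i = j then x i else 0 := hg
  conv_lhs => rw [repr_eq_killingForm hW u, repr_eq_killingForm hW v]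
  rw [bilin_sum]
  refine Finset.sum_congr rfl fun j _ => ?_
  rw [map_sum]
  simp only [map_smul, hg', smul_eq_mul, mul_ite, mul_zero, Finset.sum_ite_eq, Finset.mem_univ,
    if_true]
  rw [killingForm_comm (W j) u, killingForm_comm (W j) v]
  linear_combination (killingForm ℝ LieAlg u (W j) *
      killingForm ℝ LieAlg v (W j) * x j / 64) * milnorSign_mul_self j

end SL2R

/-! ### Reduction of Ric(g) = cT to the algebraic system -/

namespace SL2R

variable {V : Module.Basis (Fin 3) ℝ LieAlg} {T : TensorField02 𝓘(ℝ, ℝ × ℝ × ℝ) SL2R}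
  {x t : Fin 3 → ℝ} {g : Metric} {c : ℝ}

theorem eq_zero_of_isLinearMap₂ {M ι : Type*} [AddCommGroup M] [Module ℝ M]
    (b : Module.Basis ι ℝ M) {f : M → M → ℝ} (h₁ : ∀ v, IsLinearMap ℝ fun u => f u v)
    (h₂ : ∀ u, IsLinearMap ℝ fun v => f u v) (hb : ∀ i j, f (b i) (b j) = 0) (u v : M) :
    f u v = 0 := by
  have key : ∀ φ : M → ℝ, IsLinearMap ℝ φ → (∀ i, φ (b i) = 0) → ∀ u, φ u = 0 :=
    fun φ hφ h0 u => LinearMap.congr_fun (b.ext (f₁ := hφ.mk' φ) (f₂ := 0) h0) u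
  exact key _ (h₁ v) (fun i => key _ (h₂ _) (hb i) v) u

theorem isLinearMap_trace_curvatureAt_left (D : LieAlg →ₗ[ℝ] LieAlg →ₗ[ℝ] LieAlg) (v : LieAlg) :
    IsLinearMap ℝ fun u => LinearMap.trace ℝ _ (curvatureAt D u v) where
  map_add u u' := by
    rw [← map_add]
    congr 1
    ext w : 1
    simp only [curvatureAt, LinearMap.coe_mk, AddHom.coe_mk, LinearMap.add_apply, map_add, lie_add]
    abel
  map_smul a u := by
    rw [← map_smul]
    congr 1
    ext w : 1
    simp only [curvatureAt, LinearMap.coe_mk, AddHom.coe_mk, LinearMap.smul_apply, map_smul,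
      lie_smul, smul_sub]

theorem isLinearMap_trace_curvatureAt_right (D : LieAlg →ₗ[ℝ] LieAlg →ₗ[ℝ] LieAlg) (u : LieAlg) :
    IsLinearMap ℝ fun v => LinearMap.trace ℝ _ (curvatureAt D u v) where
  map_add v v' := by
    rw [← map_add]
    congr 1
    ext w : 1
    simp only [curvatureAt, LinearMap.coe_mk, AddHom.coe_mk, LinearMap.add_apply, map_add]
    abel
  map_smul a v := by
    rw [← map_smul]
    congr 1
    ext w : 1
    simp only [curvatureAt, LinearMap.coe_mk, AddHom.coe_mk, LinearMap.smul_apply, map_smul,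
      smul_sub]

theorem diagEq_iff (hx : ∀ i, 0 < x i) :
    DiagEq (t 0) (t 1) (t 2) c (x 0) (x 1) (x 2) ↔ 0 < c ∧ ∀ i, ricciDiag x i = c * t i := by
  have h0 := hx 0
  have h1 := hx 1
  have h2 := hx 2
  have e0 : ricciDiag x 0 = c * t 0 ↔
      c * t 0 * (x 1 * x 2) = 2 * (x 0 ^ 2 - (x 1 + x 2) ^ 2) := by
    show 2 * (x 0 ^ 2 - (x 1 + x 2) ^ 2) / (x 1 * x 2) = c * t 0 ↔ _
    rw [div_eq_iff (by positivity), eq_comm]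
  have e1 : ricciDiag x 1 = c * t 1 ↔
      c * t 1 * (x 0 * x 2) = 2 * (x 1 ^ 2 - (x 0 + x 2) ^ 2) := by
    show 2 * (x 1 ^ 2 - (x 0 + x 2) ^ 2) / (x 0 * x 2) = c * t 1 ↔ _
    rw [div_eq_iff (by positivity), eq_comm]
  have e2 : ricciDiag x 2 = c * t 2 ↔
      c * t 2 * (x 0 * x 1) = 2 * (x 2 ^ 2 - (x 0 - x 1) ^ 2) := by
    show 2 * (x 2 ^ 2 - (x 0 - x 1) ^ 2) / (x 0 * x 1) = c * t 2 ↔ _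
    rw [div_eq_iff (by positivity), eq_comm]
  rw [Fin.forall_fin_succ, Fin.forall_fin_two]
  exact ⟨fun h => ⟨h.k_pos, e0.2 h.eq_A, e1.2 h.eq_B, e2.2 h.eq_C⟩,
    fun h => ⟨h0, h1, h2, h.1, e0.1 h.2.1, e1.1 h.2.2.1, e2.1 h.2.2.2⟩⟩

theorem IsSolution.ricciDiag_eq (h : IsSolution T g c) (hV : IsMilnorBasis ![2, 2, -2] V)
    (hg : IsDiagIn g.inner V x) (hx : ∀ i, 0 < x i) (i j : Fin 3) :
    c * T 1 (V i) (V j) = if i = j then ricciDiag x i else 0 := by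
  rw [← ricci_of_isDiagIn hV h.1 hg hx 1 i j, h.2.2]
  rw [mulInvariantVectorField_one, mulInvariantVectorField_one]

/-- If `T` and a left-invariant metric are diagonal in a common Milnor basis, the equation
`Ric(g) = c T` is equivalent to a system of three algebraic equations. -/
theorem isSolution_iff_diagEq (hT : T.IsLeftInvariant) (hV : IsMilnorBasis ![2, 2, -2] V)
    (ht : IsDiagIn T V t) (hgi : TensorField02.IsLeftInvariant g.inner)
    (hg : IsDiagIn g.inner V x) (hx : ∀ i, 0 < x i) :
    IsSolution T g c ↔ DiagEq (t 0) (t 1) (t 2) c (x 0) (x 1) (x 2) := by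
  rw [diagEq_iff hx]
  constructor
  · intro h
    refine ⟨h.2.1, fun i => ?_⟩
    have := h.ricciDiag_eq hV hg hx i i
    rw [if_pos rfl, ht, if_pos rfl] at this
    exact this.symm
  · rintro ⟨hc, h⟩
    refine ⟨hgi, hc, fun y u v => ?_⟩
    obtain ⟨u, rfl⟩ := exists_mulInvariantVectorField_eq u
    obtain ⟨v, rfl⟩ := exists_mulInvariantVectorField_eq v
    rw [TensorField02.isLeftInvariant_iff.1 hT,
      hgi.ricci_mulInvariantVectorField g.pos (isLeviCivitaAt_milnorConnection hV hg hx),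
      ← sub_eq_zero]
    refine eq_zero_of_isLinearMap₂ V (f := fun u v =>
      LinearMap.trace ℝ _ (curvatureAt (milnorConnection V x) u v) - c * T 1 u v)
      (fun v => ?_) (fun u => ?_) (fun i j => ?_) u v
    · refine ⟨fun a b => ?_, fun a b => ?_⟩
      · rw [(isLinearMap_trace_curvatureAt_left _ v).map_add, map_add]
        show _ + _ - c * (T 1 a v + T 1 b v) = _
        ring
      · rw [(isLinearMap_trace_curvatureAt_left _ v).map_smul, map_smul]
        show a * _ - c * (a * T 1 b v) = a * (_ - _)
        ring
    · refine ⟨fun a b => ?_, fun a b => ?_⟩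
      · rw [(isLinearMap_trace_curvatureAt_right _ u).map_add, map_add]
        ring
      · rw [(isLinearMap_trace_curvatureAt_right _ u).map_smul, map_smul]
        show a * _ - c * (a * T 1 u b) = a * (_ - _)
        ring
    · have ht' : T 1 (V i) (V j) = if i = j then t i else 0 := ht i j
      rw [trace_curvatureAt_milnorConnection hV hx, ht', h]
      split_ifs <;> ring

/-- Every left-invariant metric is diagonal in some Milnor basis. -/
theorem exists_isDiagIn (g : Metric) :
    ∃ (V : Module.Basis (Fin 3) ℝ LieAlg) (x : Fin 3 → ℝ), IsMilnorBasis ![2, 2, -2] V ∧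
      (∀ i, 0 < x i) ∧ IsDiagIn g.inner V x :=
  exists_isMilnorBasis_diagonal
    (LinearMap.mk₂ ℝ (fun u v : LieAlg => g.inner 1 u v) (fun u u' v => by rw [map_add]; rfl)
      (fun a u v => by rw [map_smul]; rfl) (fun u v v' => map_add _ _ _)
      (fun a u v => map_smul _ _ _)) (g.symm 1) (g.pos 1)

/-- A metric solving the equation diagonalizes `T`. -/
theorem IsSolution.exists_diagEq (hT : T.IsLeftInvariant) (h : IsSolution T g c) :
    ∃ (V : Module.Basis (Fin 3) ℝ LieAlg) (t x : Fin 3 → ℝ), IsMilnorBasis ![2, 2, -2] V ∧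
      IsDiagIn T V t ∧ IsDiagIn g.inner V x ∧ DiagEq (t 0) (t 1) (t 2) c (x 0) (x 1) (x 2) := by
  obtain ⟨V, x, hV, hx, hg⟩ := exists_isDiagIn g
  have ht : IsDiagIn T V fun i => ricciDiag x i / c := by
    intro i j
    have h1 := h.ricciDiag_eq hV hg hx i j
    have h2 : T 1 (V i) (V j) = (if i = j then ricciDiag x i else 0) / c := by
      rw [eq_div_iff h.2.1.ne', mul_comm]
      exact h1
    refine h2.trans ?_
    split_ifs <;> simp
  exact ⟨V, _, x, hV, ht, hg, (isSolution_iff_diagEq hT hV ht h.1 hg hx).1 h⟩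

theorem exists_continuousBilinear_diagonal {E ι : Type*} [NormedAddCommGroup E] [NormedSpace ℝ E]
    [Fintype ι] [DecidableEq ι] (V : Module.Basis ι ℝ E) {x : ι → ℝ} (hx : ∀ i, 0 < x i) :
    ∃ B : E →L[ℝ] E →L[ℝ] ℝ, (∀ u v, B u v = B v u) ∧ (∀ u, u ≠ 0 → 0 < B u u) ∧
      ∀ i j, B (V i) (V j) = if i = j then x i else 0 := by
  have : FiniteDimensional ℝ E := Module.Basis.finiteDimensional_of_finite V
  let φ : ι → (E →L[ℝ] ℝ) := fun i => LinearMap.toContinuousLinearMap (V.coord i)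
  let B : E →L[ℝ] E →L[ℝ] ℝ := ∑ i, x i • (φ i).smulRight (φ i)
  have hB : ∀ u v, B u v = ∑ i, x i * (V.coord i u * V.coord i v) := fun u v => by
    simp [B, φ]
  refine ⟨B, fun u v => ?_, fun u hu => ?_, fun i j => ?_⟩
  · rw [hB, hB]
    exact Finset.sum_congr rfl fun i _ => by ring
  · rw [hB]
    obtain ⟨i, hi⟩ : ∃ i, V.coord i u ≠ 0 := by
      by_contra! hcon
      exact hu (V.forall_coord_eq_zero_iff.1 hcon)
    exact Finset.sum_pos' (fun i _ => mul_nonneg (hx i).le (mul_self_nonneg _))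
      ⟨i, Finset.mem_univ _, mul_pos (hx i) (mul_self_pos.2 hi)⟩
  · rw [hB]
    simp only [V.coord_apply, V.repr_self, Finsupp.single_apply]
    rcases eq_or_ne i j with rfl | hij
    · simp
    · rw [if_neg hij]
      exact Finset.sum_eq_zero fun k _ => by grind

/-- There is a left-invariant metric with given positive diagonal values. -/
theorem exists_metric (V : Module.Basis (Fin 3) ℝ LieAlg) (hx : ∀ i, 0 < x i) :
    ∃ g : Metric, TensorField02.IsLeftInvariant g.inner ∧ IsDiagIn g.inner V x := by
  obtain ⟨B, hs, hp, hB⟩ := exists_continuousBilinear_diagonal (E := ℝ × ℝ × ℝ) V hx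
  have h1 : ∀ u v : LieAlg, leftInvariantTensor 𝓘(ℝ, ℝ × ℝ × ℝ) B (1 : SL2R) u v =
      (B : ℝ × ℝ × ℝ → _) u v := fun u v => by
    have h1 := leftInvariantTensor_mulInvariantVectorField B (1 : SL2R) u v
    rwa [mulInvariantVectorField_one, mulInvariantVectorField_one] at h1
  refine ⟨leftInvariantMetric B hs hp, TensorField02.isLeftInvariant_iff.2 fun y u v => ?_,
    fun i j => (h1 _ _).trans (hB i j)⟩
  exact (leftInvariantTensor_mulInvariantVectorField B y u v).trans (h1 u v).symm

theorem sameUpToScaling_iff {g g' : Metric} {x' : Fin 3 → ℝ}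
    (hgi : TensorField02.IsLeftInvariant g.inner)
    (hgi' : TensorField02.IsLeftInvariant g'.inner)
    (hg : IsDiagIn g.inner V x) (hg' : IsDiagIn g'.inner V x') :
    SameUpToScaling g g' ↔ ∃ s : ℝ, 0 < s ∧ ∀ i, x' i = s * x i := by
  constructor
  · rintro ⟨s, hs, h⟩
    refine ⟨s, hs, fun i => ?_⟩
    have h1 := hg i i
    have h2 := hg' i i
    rw [if_pos rfl] at h1 h2
    rw [← h1, ← h2, h]
    rfl
  · rintro ⟨s, hs, h⟩
    refine ⟨s, hs, fun y => ?_⟩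
    have hs : TensorField02.IsLeftInvariant (fun y => s • g.inner y) := fun a y u v =>
      congrArg (fun r => s * r) (hgi a y u v)
    refine congrFun (hgi'.ext hs ?_) y
    ext u v
    rw [← sub_eq_zero]
    refine eq_zero_of_isLinearMap₂ V (f := fun u v => g'.inner 1 u v - (s • g.inner 1) u v)
      (fun v => ?_) (fun u => ?_) (fun i j => ?_) u v
    · refine ⟨fun a b => ?_, fun a b => ?_⟩
      · exact congrArg (fun φ => φ v) ((g'.inner 1 - s • g.inner 1).map_add a b)
      · exact congrArg (fun φ => φ v) ((g'.inner 1 - s • g.inner 1).map_smul a b)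
    · exact ((g'.inner 1 - s • g.inner 1) u).toLinearMap.isLinear
    · have h1 : g.inner 1 (V i) (V j) = if i = j then x i else 0 := hg i j
      have h2 : g'.inner 1 (V i) (V j) = if i = j then x' i else 0 := hg' i j
      show g'.inner 1 (V i) (V j) - s * g.inner 1 (V i) (V j) = 0
      rw [h1, h2, h]
      split_ifs <;> ring

end SL2R

/-! ### Independence of the Milnor basis -/

namespace SL2R

variable {V W : Module.Basis (Fin 3) ℝ LieAlg} {T : TensorField02 𝓘(ℝ, ℝ × ℝ × ℝ) SL2R}
  {t t' x : Fin 3 → ℝ} {k : ℝ}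

/-- For two Milnor bases, `∑ i, e_i b_ij² = 64 e_j`, where `b` is the matrix of the Killing form. -/
theorem sum_killingForm_sq (hV : IsMilnorBasis ![2, 2, -2] V) (hW : IsMilnorBasis ![2, 2, -2] W)
    (j : Fin 3) :
    killingForm ℝ LieAlg (V 0) (W j) ^ 2 + killingForm ℝ LieAlg (V 1) (W j) ^ 2 -
      killingForm ℝ LieAlg (V 2) (W j) ^ 2 = 64 * milnorSign j := by
  have h := sum_killingForm_left hW hV j j
  rw [if_pos rfl, Fin.sum_univ_three, killingForm_comm (W j), killingForm_comm (W j),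
    killingForm_comm (W j)] at h
  rw [← h]
  show _ = (1 : ℝ) * _ + 1 * _ + -1 * _
  ring

/-- Two vectors that are negative for a form of signature (2, 1) cannot be orthogonal. -/
theorem killingForm_two_two_ne_zero (hV : IsMilnorBasis ![2, 2, -2] V)
    (hW : IsMilnorBasis ![2, 2, -2] W) : killingForm ℝ LieAlg (V 2) (W 2) ≠ 0 := by
  intro h
  have h1 := sum_killingForm_sq hV hW 2
  rw [h, show milnorSign 2 = -1 from rfl] at h1
  nlinarith [sq_nonneg (killingForm ℝ LieAlg (V 0) (W 2)),
    sq_nonneg (killingForm ℝ LieAlg (V 1) (W 2))]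

/-- The orthogonal complement of `V 0` and `V 1` is a negative line and cannot contain the positive
vector `W j`. -/
theorem exists_killingForm_ne_zero (hV : IsMilnorBasis ![2, 2, -2] V)
    (hW : IsMilnorBasis ![2, 2, -2] W) {j : Fin 3} (hj : milnorSign j = 1) :
    killingForm ℝ LieAlg (V 0) (W j) ≠ 0 ∨ killingForm ℝ LieAlg (V 1) (W j) ≠ 0 := by
  by_contra! h
  have h1 := sum_killingForm_sq hV hW j
  rw [h.1, h.2, hj] at h1
  nlinarith [sq_nonneg (killingForm ℝ LieAlg (V 2) (W j))]

theorem eq_of_killingForm_ne_zero (hV : IsMilnorBasis ![2, 2, -2] V)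
    (hW : IsMilnorBasis ![2, 2, -2] W) (hTV : IsDiagIn T V t) (hTW : IsDiagIn T W t') {i j : Fin 3}
    (h : killingForm ℝ LieAlg (V i) (W j) ≠ 0) : milnorSign i * t i = milnorSign j * t' j :=
  sub_eq_zero.1 ((mul_eq_zero.1 (eigenvalue_relation hV hW hTV hTW i j)).resolve_right h)

theorem eq_two_of_isDiagIn (hV : IsMilnorBasis ![2, 2, -2] V)
    (hW : IsMilnorBasis ![2, 2, -2] W) (hTV : IsDiagIn T V t) (hTW : IsDiagIn T W t') :
    t' 2 = t 2 := by
  have h := eq_of_killingForm_ne_zero hV hW hTV hTW (killingForm_two_two_ne_zero hV hW)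
  rw [show milnorSign 2 = -1 from rfl] at h
  linarith

theorem eq_or_eq_of_isDiagIn (hV : IsMilnorBasis ![2, 2, -2] V)
    (hW : IsMilnorBasis ![2, 2, -2] W) (hTV : IsDiagIn T V t) (hTW : IsDiagIn T W t') {j : Fin 3}
    (hj : milnorSign j = 1) : t' j = t 0 ∨ t' j = t 1 := by
  refine (exists_killingForm_ne_zero hV hW hj).imp (fun h => ?_) (fun h => ?_)
  · have := eq_of_killingForm_ne_zero hV hW hTV hTW h
    rw [hj, show milnorSign 0 = 1 from rfl] at this
    linarith
  · have := eq_of_killingForm_ne_zero hV hW hTV hTW h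
    rw [hj, show milnorSign 1 = 1 from rfl] at this
    linarith

theorem UniqueCase.add_ne_zero (ht : UniqueCase t) : t 0 + t 2 ≠ 0 ∧ t 1 + t 2 ≠ 0 := by
  rcases ht with ⟨h0, h1, h2, h⟩ | ⟨h0, h1, h2, h⟩ | ⟨h0, h1, h2, h⟩ | ⟨h0, h1, h2, h⟩
  · exact ⟨by linarith, by linarith⟩
  · exact ⟨by linarith, by linarith⟩
  · rw [max_lt_iff] at h
    exact ⟨by linarith, by linarith⟩
  · rw [lt_min_iff] at h
    exact ⟨by linarith, by linarith⟩

/-- In the cases of uniqueness, a metric that solves the equation is diagonal in every Milnor basis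
in which the tensor is diagonal. -/
theorem UniqueCase.exists_isDiagIn (ht : UniqueCase t) (hV : IsMilnorBasis ![2, 2, -2] V)
    (hW : IsMilnorBasis ![2, 2, -2] W) (hTV : IsDiagIn T V t) (hTW : IsDiagIn T W t')
    (hk : DiagEq (t' 0) (t' 1) (t' 2) k (x 0) (x 1) (x 2))
    {g : TensorField02 𝓘(ℝ, ℝ × ℝ × ℝ) SL2R} (hg : IsDiagIn g W x) :
    ∃ x', IsDiagIn g V x' := by
  obtain ⟨h02, h12⟩ := ht.add_ne_zero
  suffices h : ∀ i k, i ≠ k → g 1 (V i) (V k) = 0 by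
    refine ⟨fun i => g 1 (V i) (V i), fun i k => ?_⟩
    rcases eq_or_ne i k with rfl | hik
    · simp
    · rw [if_neg hik]; exact h i k hik
  -- Each `W j` is an eigenvector, so it cannot pair nontrivially with two eigenvectors of different
  -- eigenvalues.
  have hprod : ∀ i k, milnorSign i * t i ≠ milnorSign k * t k → ∀ j,
      killingForm ℝ LieAlg (V i) (W j) * killingForm ℝ LieAlg (V k) (W j) = 0 := by
    intro i k hik j
    by_contra hne
    rw [mul_eq_zero, not_or] at hne
    exact hik ((eq_of_killingForm_ne_zero hV hW hTV hTW hne.1).trans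
      (eq_of_killingForm_ne_zero hV hW hTV hTW hne.2).symm)
  have hzero : ∀ i k, milnorSign i * t i ≠ milnorSign k * t k → g 1 (V i) (V k) = 0 := by
    intro i k hik
    rw [tensor_eq_sum hW hg]
    exact Finset.sum_eq_zero fun j _ => by rw [hprod i k hik j]; simp
  have e0 : milnorSign 0 * t 0 = t 0 := one_mul _
  have e1 : milnorSign 1 * t 1 = t 1 := one_mul _
  have e2 : milnorSign 2 * t 2 = -t 2 := neg_one_mul _
  have n02 : milnorSign 0 * t 0 ≠ milnorSign 2 * t 2 := by
    rw [e0, e2]; exact fun h => h02 (by linarith)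
  have n12 : milnorSign 1 * t 1 ≠ milnorSign 2 * t 2 := by
    rw [e1, e2]; exact fun h => h12 (by linarith)
  have key : g 1 (V 0) (V 1) = 0 ∧ g 1 (V 1) (V 0) = 0 := by
    rcases ne_or_eq (t 0) (t 1) with h01 | h01
    · exact ⟨hzero 0 1 (by rwa [e0, e1]), hzero 1 0 (by rw [e0, e1]; exact h01.symm)⟩
    -- For `t 0 = t 1` the eigenspace is a plane and its basis is not determined. Then `t' = t`, and
    -- it remains to show that `g` is a multiple of `K` on this plane.
    have ht0 : t' 0 = t 0 := by
      rcases eq_or_eq_of_isDiagIn hV hW hTV hTW (j := 0) rfl with h | h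
      · exact h
      · rw [h, h01]
    have ht1 : t' 1 = t 1 := by
      rcases eq_or_eq_of_isDiagIn hV hW hTV hTW (j := 1) rfl with h | h
      · rw [h, h01]
      · exact h
    rw [ht0, ht1, eq_two_of_isDiagIn hV hW hTV hTW] at hk
    have hk' := hk.swap
    rw [← h01] at hk'
    have hx : x 1 = x 0 := by
      -- Exchanging `x 0` and `x 1` gives another solution with the same `x 2`, so uniqueness up to
      -- scaling forces scale 1 and `x 1 = x 0`.
      obtain ⟨-, s, hs, e1, e2, e3⟩ := DiagEq.eq_of_uniqueCase ht hk (by rw [← h01]; exact hk')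
      have : s = 1 := by
        have := hk.z_pos.ne'
        refine mul_right_cancel₀ this ?_
        linarith
      rw [e1, this, one_mul]
    have h22 := killingForm_two_two_ne_zero hV hW
    have b02 : killingForm ℝ LieAlg (V 0) (W 2) = 0 :=
      (mul_eq_zero.1 (hprod 0 2 n02 2)).resolve_right h22
    have hs := sum_killingForm_left hV hW 0 1
    rw [if_neg (by decide), Fin.sum_univ_three, b02] at hs
    have hs' : killingForm ℝ LieAlg (V 0) (W 0) * killingForm ℝ LieAlg (V 1) (W 0) +
        killingForm ℝ LieAlg (V 0) (W 1) * killingForm ℝ LieAlg (V 1) (W 1) = 0 := by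
      rw [show milnorSign 0 = 1 from rfl, show milnorSign 1 = 1 from rfl] at hs
      linarith
    rw [tensor_eq_sum hW hg, tensor_eq_sum hW hg, Fin.sum_univ_three, Fin.sum_univ_three, b02, hx]
    constructor <;> linear_combination x 0 / 64 * hs'
  intro i k hik
  fin_cases i <;> fin_cases k
  · exact absurd rfl hik
  · exact key.1
  · exact hzero 0 2 n02
  · exact key.2
  · exact absurd rfl hik
  · exact hzero 1 2 n12
  · exact hzero 2 0 n02.symm
  · exact hzero 2 1 n12.symm
  · exact absurd rfl hik

/-- When `t 2 = 0`, another Milnor basis may permute the first two entries, so only membership of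
`t' 0` and `t' 1` in `{A, 0}` is used. As `C = 0`, either `P` or `Q` vanishes, and the entry for
which `k` times it is `-8` cannot be 0, so it is `A`. -/
theorem mul_eq_neg_eight_of_familyCase {A x y z : ℝ} (hV : IsMilnorBasis ![2, 2, -2] V)
    (hW : IsMilnorBasis ![2, 2, -2] W) (hTV : IsDiagIn T V t) (hTW : IsDiagIn T W t')
    (hk : DiagEq (t' 0) (t' 1) (t' 2) k x y z)
    (ht : (t 0 = A ∧ t 1 = A ∧ t 2 = -A ∧ A < 0) ∨
      (t 2 = 0 ∧ (t 0 = A ∨ t 0 = 0) ∧ (t 1 = A ∨ t 1 = 0))) :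
    k * A = -8 := by
  have h2 := eq_two_of_isDiagIn hV hW hTV hTW
  have h0 := eq_or_eq_of_isDiagIn hV hW hTV hTW (j := 0) rfl
  have h1 := eq_or_eq_of_isDiagIn hV hW hTV hTW (j := 1) rfl
  rcases ht with ⟨e0, e1, e2, hA⟩ | ⟨e2, e0, e1⟩
  · have h0' : t' 0 = A := by rcases h0 with h | h <;> rw [h] <;> assumption
    rw [← h0']
    refine hk.mul_eq_neg_eight_of_add_eq_zero (by rw [h0']; exact hA.ne) ?_
    rw [h0', h2, e2]
    ring
  · have h0' : t' 0 = A ∨ t' 0 = 0 := by rcases h0 with h | h <;> rw [h] <;> assumption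
    have h1' : t' 1 = A ∨ t' 1 = 0 := by rcases h1 with h | h <;> rw [h] <;> assumption
    have hC := hk.C_mul_eq
    rw [h2, e2, mul_zero] at hC
    rcases mul_eq_zero.1 (by linarith : (x - y - z) * (y - x - z) = 0) with h | h
    · have h3 := hk.mul_eq_neg_eight_of_eq_add (by linarith)
      rcases h1' with h4 | h4
      · rwa [h4] at h3
      · rw [h4] at h3; linarith
    · have h3 := hk.swap.mul_eq_neg_eight_of_eq_add (by linarith)
      rcases h0' with h4 | h4
      · rwa [h4] at h3
      · rw [h4] at h3; linarith

end SL2R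

/-! ### Existence, uniqueness and families of solutions -/

namespace SL2R

variable {V : Module.Basis (Fin 3) ℝ LieAlg} {T : TensorField02 𝓘(ℝ, ℝ × ℝ × ℝ) SL2R}
  {t : Fin 3 → ℝ} {c : ℝ}

theorem exists_metric_of_diagEq (hT : T.IsLeftInvariant) (hV : IsMilnorBasis ![2, 2, -2] V)
    (ht : IsDiagIn T V t) {x y z : ℝ} (h : DiagEq (t 0) (t 1) (t 2) c x y z) :
    ∃ g : Metric, IsSolution T g c ∧ IsDiagIn g.inner V ![x, y, z] := by
  have hx : ∀ i, 0 < ![x, y, z] i := by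
    rw [Fin.forall_fin_succ, Fin.forall_fin_two]
    exact ⟨h.x_pos, h.y_pos, h.z_pos⟩
  obtain ⟨g, hgi, hg⟩ := exists_metric V hx
  exact ⟨g, (isSolution_iff_diagEq hT hV ht hgi hg hx).2 h, hg⟩

theorem UniqueCase.existsUnique_solution (hT : T.IsLeftInvariant)
    (hV : IsMilnorBasis ![2, 2, -2] V) (ht : IsDiagIn T V t) (hu : UniqueCase t) :
    ∃ (g : Metric) (c : ℝ), IsSolution T g c ∧
      ∀ (g' : Metric) (c' : ℝ), IsSolution T g' c' → c' = c ∧ SameUpToScaling g g' := by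
  obtain ⟨c, x, y, z, h⟩ := DiagEq.exists_of_uniqueCase hu
  obtain ⟨g, hs, hg⟩ := exists_metric_of_diagEq hT hV ht h
  refine ⟨g, c, hs, fun g' c' hs' => ?_⟩
  obtain ⟨W, t', x', hW, ht', hg', h'⟩ := hs'.exists_diagEq hT
  -- The competing metric is diagonal in the original basis `V` too, so both metrics solve the same
  -- algebraic system.
  obtain ⟨y', hy'⟩ := hu.exists_isDiagIn hV hW ht ht' h' hg'
  have hpos : ∀ i, 0 < y' i := fun i => by
    have h1 := hy' i i
    rw [if_pos rfl] at h1
    rw [← h1]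
    exact g'.pos 1 _ (V.ne_zero i)
  have h2 := (isSolution_iff_diagEq hT hV ht hs'.1 hy' hpos).1 hs'
  obtain ⟨hc, s, hs0, e0, e1, e2⟩ := DiagEq.eq_of_uniqueCase hu h h2
  refine ⟨hc, (sameUpToScaling_iff hs.1 hs'.1 hg hy').2 ⟨s, hs0, ?_⟩⟩
  rw [Fin.forall_fin_succ, Fin.forall_fin_two]
  exact ⟨e0, e1, e2⟩

theorem exists_family (hT : T.IsLeftInvariant) (hV : IsMilnorBasis ![2, 2, -2] V)
    (ht : IsDiagIn T V t) {x y z : ℕ → ℝ}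
    (h : ∀ n, DiagEq (t 0) (t 1) (t 2) c (x n) (y n) (z n))
    (hne : ∀ m n s, x n = s * x m → y n = s * y m → z n = s * z m → m = n) :
    ∃ γ : ℕ → Metric, (∀ n, IsSolution T (γ n) c) ∧
      Pairwise fun m n => ¬ SameUpToScaling (γ m) (γ n) := by
  choose γ hγ hd using fun n => exists_metric_of_diagEq hT hV ht (h n)
  refine ⟨γ, hγ, fun m n hmn hs => hmn ?_⟩
  obtain ⟨s, -, h⟩ := (sameUpToScaling_iff (hγ m).1 (hγ n).1 (hd m) (hd n)).1 hs
  exact hne m n s (h 0) (h 1) (h 2)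

theorem FamilyCase.exists_solutions (hT : T.IsLeftInvariant)
    (hV : IsMilnorBasis ![2, 2, -2] V) (ht : IsDiagIn T V t) (hf : FamilyCase t) :
    ∃ c : ℝ, (∃ γ : ℕ → Metric, (∀ n, IsSolution T (γ n) c) ∧
        Pairwise fun m n => ¬ SameUpToScaling (γ m) (γ n)) ∧
      ∀ (g' : Metric) (c' : ℝ), IsSolution T g' c' → c' = c := by
  have hc : ∀ {A : ℝ}, A < 0 → ((t 0 = A ∧ t 1 = A ∧ t 2 = -A ∧ A < 0) ∨
      (t 2 = 0 ∧ (t 0 = A ∨ t 0 = 0) ∧ (t 1 = A ∨ t 1 = 0))) →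
      ∀ (g' : Metric) (c' : ℝ), IsSolution T g' c' → c' = -8 / A := by
    intro A hA h g' c' hs'
    obtain ⟨W, t', x', hW, ht', hg', h'⟩ := hs'.exists_diagEq hT
    rw [eq_div_iff hA.ne]
    exact mul_eq_neg_eight_of_familyCase hV hW ht ht' h' h
  rcases hf with ⟨h01, h12, h2⟩ | ⟨h0, h1, h2⟩ | ⟨h1, h0, h2⟩
  · have h0 : t 0 < 0 := by linarith
    refine ⟨_, ?_, hc h0 (.inl ⟨rfl, h01.symm, by linarith, h0⟩)⟩
    -- The constant coordinate 1 forces a scaling factor between two members to be 1; the shift `n +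
    -- 1` keeps the entry positive at `n = 0`.
    refine exists_family (x := fun n => (n : ℝ) + 1) (y := fun _ => 1)
      (z := fun n => (n : ℝ) + 1 + 1) hT hV ht (fun n => ?_) fun m n s e0 e1 _ => ?_
    · rw [← h01, show t 2 = -t 0 by linarith]
      exact .of_eq_neg h0 (by positivity) one_pos
    · obtain rfl : s = 1 := by linarith
      exact_mod_cast (by linarith : (m : ℝ) = n)
  · refine ⟨_, ?_, hc h0 (.inr ⟨h2, .inl rfl, .inr h1⟩)⟩
    refine exists_family (x := fun n => 1) (y := fun n => 1 + ((n : ℝ) + 1))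
      (z := fun n => (n : ℝ) + 1) hT hV ht (fun n => ?_) fun m n s e0 _ e1 => ?_
    · rw [h1, h2]
      exact .of_neg_zero_zero h0 one_pos (by positivity)
    · obtain rfl : s = 1 := by linarith
      exact_mod_cast (by linarith : (m : ℝ) = n)
  · refine ⟨_, ?_, hc h1 (.inr ⟨h2, .inr h0, .inl rfl⟩)⟩
    refine exists_family (x := fun n => 1 + ((n : ℝ) + 1)) (y := fun n => 1)
      (z := fun n => (n : ℝ) + 1) hT hV ht (fun n => ?_) fun m n s _ e0 e1 => ?_
    · rw [h0, h2]
      exact (DiagEq.of_neg_zero_zero h1 one_pos (by positivity)).swap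
    · obtain rfl : s = 1 := by linarith
      exact_mod_cast (by linarith : (m : ℝ) = n)

end SL2R

end

theorem mainTheorem2 (T : TensorField02 𝓘(ℝ, ℝ × ℝ × ℝ) SL2R) (hT : T.IsLeftInvariant) :
    -- solvability
    ((∃ (g : SL2R.Metric) (c : ℝ), SL2R.IsSolution T g c) ↔
      ∃ (V : Module.Basis (Fin 3) ℝ SL2R.LieAlg) (t : Fin 3 → ℝ),
        SL2R.IsMilnorBasis ![2, 2, -2] V ∧ SL2R.IsDiagIn T V t ∧
          (SL2R.UniqueCase t ∨ SL2R.FamilyCase t)) ∧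
    -- the solution is unique up to scaling of the metric
    (∀ (V : Module.Basis (Fin 3) ℝ SL2R.LieAlg) (t : Fin 3 → ℝ),
      SL2R.IsMilnorBasis ![2, 2, -2] V → SL2R.IsDiagIn T V t → SL2R.UniqueCase t →
        ∃ (g : SL2R.Metric) (c : ℝ), SL2R.IsSolution T g c ∧
          ∀ (g' : SL2R.Metric) (c' : ℝ), SL2R.IsSolution T g' c' →
            c' = c ∧ SL2R.SameUpToScaling g g') ∧
    -- infinitely many metrics up to scaling, all with the same constant
    (∀ (V : Module.Basis (Fin 3) ℝ SL2R.LieAlg) (t : Fin 3 → ℝ),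
      SL2R.IsMilnorBasis ![2, 2, -2] V → SL2R.IsDiagIn T V t → SL2R.FamilyCase t →
        ∃ c : ℝ,
          (∃ γ : ℕ → SL2R.Metric, (∀ n, SL2R.IsSolution T (γ n) c) ∧
            Pairwise fun m n => ¬ SL2R.SameUpToScaling (γ m) (γ n)) ∧
          ∀ (g' : SL2R.Metric) (c' : ℝ), SL2R.IsSolution T g' c' → c' = c) := by
  have hu := fun V t (hV : SL2R.IsMilnorBasis ![2, 2, -2] V) (ht : SL2R.IsDiagIn T V t) h =>
    SL2R.UniqueCase.existsUnique_solution hT hV ht h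
  have hf := fun V t (hV : SL2R.IsMilnorBasis ![2, 2, -2] V) (ht : SL2R.IsDiagIn T V t) h =>
    SL2R.FamilyCase.exists_solutions hT hV ht h
  refine ⟨⟨?_, ?_⟩, hu, hf⟩
  · rintro ⟨g, c, h⟩
    obtain ⟨V, t, x, hV, ht, -, h⟩ := h.exists_diagEq hT
    exact ⟨V, t, hV, ht, h.uniqueCase_or_familyCase⟩
  · rintro ⟨V, t, hV, ht, h | h⟩
    · obtain ⟨g, c, hs, -⟩ := hu V t hV ht h
      exact ⟨g, c, hs⟩
    · obtain ⟨c, ⟨γ, hs, -⟩, -⟩ := hf V t hV ht h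
      exact ⟨γ 0, c, hs 0⟩
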